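/- \textbf{Setting.} Let $\mathbb T$ be the unit circle and let $\mathfrak c(z)=-i\,\frac{z+1}{z-1}$ be the Cayley map from the disk to the upper half-plane, so that $\mathfrak c(1)=\infty$, $\mathfrak c(i)=-1$, $\mathfrak c(-1)=0$. Let $E$ be the set of (unoriented) edges of the Farey tessellation of the disk, i.e. the preimages under $\mathfrak c$ of the geodesics $(\gamma(\infty),\gamma(0))$, $\gamma\in SL(2,\mathbb Z)$, and let $V=\mathfrak c^{-1}(\mathbb Q\cup\{\infty\})$ be its set of vertices. For $v=\mathfrak c^{-1}(\gamma(\infty))\in V$, the edges incident to $v$ form $\mathrm{fan}(v)=(e_n)_{n\in\mathbb Z}$, where $\mathfrak c(e_n)=(\gamma(\infty),\gamma(n))$; replacing $\gamma$ by another $\gamma'\in SL(2,\mathbb Z)$ with $\gamma'(\infty)=\gamma(\infty)$ only shifts the index. All circle homeomorphisms are orientation preserving and, in this statement, fix $1,i,-1$. If $e=(a,c)\in E$ and $(a,b,c,d)$ are the vertices, in counterclockwise order, of the two Farey triangles containing $e$, the \emph{shear coordinate} of $h$ is $$s_h(e)=\log\frac{(h(b)-h(a))(h(d)-h(c))}{(h(c)-h(b))(h(d)-h(a))}.$$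 A function $s:E\to\mathbb R$ (a shear function) \emph{induces} $h$ if $s_h=s$. The homeomorphism $h$ is \emph{quasisymmetric} if there is $K\ge 1$ with $$\frac1K\le\frac{|h(e^{i(x+t)})-h(e^{ix})|}{|h(e^{ix})-h(e^{i(x-t)})|}\le K\qquad\text{for all }x\in\mathbb R,\ 0<t\le\pi/2 .$$ The universal Teichm\"uller space $T(\mathbb D)=\mathrm{QS}(\mathbb T)/\mathrm{M\ddot ob}(\mathbb T)$ is identified with the set of quasisymmetric homeomorphisms fixing $1,i,-1$, and these are identified with their shear coordinates. Let $\mathcal P$ be the set of $s:E\to\mathbb R$ such that for every $v\in V$ with $\mathrm{fan}(v)=(e_n)_{n\in\mathbb Z}$ the limits $\lim_{n\to\infty}\sum_{k=-n}^{-1}s(e_k)$ and $\lim_{n\to\infty}\sum_{k=0}^{n}s(e_k)$ exist in $\mathbb R$. For $s\in\mathcal P$, $v\in V$ and $e\in\mathrm{fan}(v)$ let $p_{s,v}(e+)$ and $p_{s,v}(e-)$ be the (conditionally convergent) sums of $s$ over the edges of $\mathrm{fan}(v)$ with strictly larger, respectively strictly smaller, index than $e$. For $e=(a,b)\in E$ put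 $$\vartheta(e)=\tfrac14\big(p_{s,a}(e-)-p_{s,a}(e+)+p_{s,b}(e-)-p_{s,b}(e+)\big),$$ and let $\mathcal H=\{s\in\mathcal P:\sum_{e\in E}\vartheta(e)^2<\infty\}$. \textbf{Statement.} (1) Let $s:E\to\mathbb R$, and suppose that there is $M\ge0$ such that for all $v\in V$ with $\mathrm{fan}(v)=(e_i)_{i\in\mathbb Z}$ and all integers $n\le m$, $$\Big|\sum_{i=n}^m s(e_i)\Big|\le M .$$ Then there is exactly one homeomorphism $h:\mathbb T\to\mathbb T$ as above that is induced by $s$, and $h$ is quasisymmetric. (2) In particular, if $h$ is a circle homeomorphism as above with $s_h\in\mathcal H$, then $h$ is quasisymmetric; and every $s\in\mathcal H$ induces a quasisymmetric circle homeomorphism, i.e. $\mathcal H\subset T(\mathbb D)$. -/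

import Mathlib

open Filter Topology OnePoint
open scoped MatrixGroups

noncomputable section

namespace FareyShear

/-! ### The Farey tessellation of the disk -/

/-- The inverse `w ↦ (w - i) / (w + i)` of the Cayley map `z ↦ -i (z + 1) / (z - 1)`, on the
boundary `ℝ ∪ {∞}` of the upper half-plane: it sends `0, ∞, -1` to `-1, 1, i`. -/
def cayleyInv (w : OnePoint ℝ) : Circle :=
  w.elim 1 fun x : ℝ =>
    Circle.ofConjDivSelf ((x : ℂ) + Complex.I) fun h => by simpa using congrArg Complex.im h

/-- The point of the circle that corresponds to `γ(w)`, where `γ ∈ SL(2, ℤ)` acts on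
`ℝ ∪ {∞}` by `w ↦ (a w + b) / (c w + d)`. -/
def pt (γ : SL(2, ℤ)) (w : OnePoint ℝ) : Circle :=
  cayleyInv ((Matrix.SpecialLinearGroup.mapGL ℝ γ) • w)

/-- The edges of the Farey tessellation: the unordered pairs of endpoints of the images of the
geodesic `(0, ∞)` under `SL(2, ℤ)`, transported to the disk. -/
def edges : Set (Sym2 Circle) := {e | ∃ γ : SL(2, ℤ), e = s(pt γ ∞, pt γ ((0 : ℝ) : OnePoint ℝ))}

/-- The type `E` of edges of the Farey tessellation. -/
abbrev Edge : Type := edges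

lemma pt_mul (γ δ : SL(2, ℤ)) (w : OnePoint ℝ) :
    pt (γ * δ) w = cayleyInv ((Matrix.SpecialLinearGroup.mapGL ℝ γ) •
      ((Matrix.SpecialLinearGroup.mapGL ℝ δ) • w)) := by
  rw [pt, map_mul, mul_smul]

lemma mapGL_entry (γ : SL(2, ℤ)) (i j : Fin 2) :
    (Matrix.SpecialLinearGroup.mapGL ℝ γ) i j = (γ i j : ℝ) := by
  simp

lemma T_zpow_infty (n : ℤ) :
    (Matrix.SpecialLinearGroup.mapGL ℝ (ModularGroup.T ^ n)) • (∞ : OnePoint ℝ) = ∞ := by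
  rw [OnePoint.smul_infty_eq_self_iff, mapGL_entry, ModularGroup.coe_T_zpow]
  simp

lemma T_zpow_coe (n : ℤ) (x : ℝ) :
    (Matrix.SpecialLinearGroup.mapGL ℝ (ModularGroup.T ^ n)) • (x : OnePoint ℝ) =
      ((x + n : ℝ) : OnePoint ℝ) := by
  rw [OnePoint.smul_some_eq_ite]
  simp only [mapGL_entry, ModularGroup.coe_T_zpow]
  simp

/-- The fan of the vertex `v = γ(∞)`: its edges are `e_n = (γ(∞), γ(n))`, `n ∈ ℤ`. Since `γ⁻¹`
is a conformal map that sends `v` to `∞` and `e_n` to the vertical line over `n`, the index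
increases from left to right. As `γ` varies over `SL(2, ℤ)`, this gives all
vertices `v` and all choices of `e_0` in the fan of `v`. -/
def fan (γ : SL(2, ℤ)) (n : ℤ) : Edge :=
  ⟨s(pt γ ∞, pt γ ((n : ℝ) : OnePoint ℝ)), γ * ModularGroup.T ^ n, by
    rw [pt_mul, pt_mul, T_zpow_infty, T_zpow_coe, zero_add]; rfl⟩

/-- A Farey edge `e` is `(γ(∞), γ(0))` for some `γ ∈ SL(2, ℤ)`; we fix one such `γ`. It is unique
up to sign and reversal of the edge, and the definitions below do not depend
on it (`shearCoord_fan_zero`, `diamond_fan_zero`). -/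
def frame (e : Edge) : SL(2, ℤ) := e.2.choose

/-! ### Shears -/

/-- The cross ratio. -/
def cr (a b c d : ℂ) : ℂ := ((b - a) * (d - c)) / ((c - b) * (d - a))

/-- The shear `log cr(a, b, c, d)` of the quad `(a, b, c, d)` along its diagonal `(a, c)`. (The
cross ratio of four distinct points in counterclockwise order is a positive real number.) -/
def shear (a b c d : Circle) : ℝ := (Complex.log (cr a b c d)).re

/-- The shear along `h(e)` of the image under `h` of the Farey quad around `e = (γ(∞), γ(0))`,
which is `(γ(∞), γ(-1), γ(0), γ(1))` in counterclockwise order. -/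
def quadShear (h : Circle ≃ₜ Circle) (γ : SL(2, ℤ)) : ℝ :=
  shear (h (pt γ ∞)) (h (pt γ ((-1 : ℝ) : OnePoint ℝ)))
    (h (pt γ ((0 : ℝ) : OnePoint ℝ))) (h (pt γ ((1 : ℝ) : OnePoint ℝ)))

/-- The shear coordinate `s_h : E → ℝ`. -/
def shearCoord (h : Circle ≃ₜ Circle) (e : Edge) : ℝ := quadShear h (frame e)

/-! ### Circle homeomorphisms -/

/-- `h` preserves the orientation: it lifts to a strictly increasing continuous map of `ℝ`. -/
def OrientationPreserving (h : Circle ≃ₜ Circle) : Prop :=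
  ∃ f : ℝ → ℝ, Continuous f ∧ StrictMono f ∧ ∀ x, h (Circle.exp x) = Circle.exp (f x)

/-- The orientation-preserving circle homeomorphisms that fix `1`, `i` and `-1`. -/
def normalizedHomeo : Set (Circle ≃ₜ Circle) :=
  {h | OrientationPreserving h ∧
    ∀ z : Circle, (z : ℂ) ∈ ({1, Complex.I, -1} : Set ℂ) → h z = z}

/-- An orientation-preserving circle homeomorphism `h` is quasisymmetric if, for some `K ≥ 1`,
`K⁻¹ ≤ |h(e^{i(x+t)}) - h(e^{ix})| / |h(e^{ix}) - h(e^{i(x-t)})| ≤ K`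
for all real `x` and all `0 < t ≤ π / 2`. -/
def Quasisymmetric (h : Circle ≃ₜ Circle) : Prop :=
  OrientationPreserving h ∧ ∃ K : ℝ, 1 ≤ K ∧ ∀ x t : ℝ, 0 < t → t ≤ Real.pi / 2 →
    dist (h (Circle.exp (x + t))) (h (Circle.exp x)) /
      dist (h (Circle.exp x)) (h (Circle.exp (x - t))) ∈ Set.Icc K⁻¹ K

/-- The universal Teichmüller space `T(𝔻) = QS(𝕋) / Möb(𝕋)`, identified with the set of
quasisymmetric circle homeomorphisms that fix `1`, `i` and `-1`. -/
def universalTeichmuller : Set (Circle ≃ₜ Circle) := {h ∈ normalizedHomeo | Quasisymmetric h}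

/-- `s : E → ℝ` induces the normalized circle homeomorphism `h`, i.e. `s_h = s`. -/
def Induces (s : Edge → ℝ) (h : Circle ≃ₜ Circle) : Prop :=
  h ∈ normalizedHomeo ∧ shearCoord h = s

/-! ### Conditions on shear functions -/

/-- The sums of `s` over finite runs of consecutive edges in a fan are bounded by a constant that
depends neither on the run nor on the fan. -/
def FanSumsBounded (s : Edge → ℝ) : Prop :=
  ∃ M : ℝ, 0 ≤ M ∧ ∀ (γ : SL(2, ℤ)) (n m : ℤ), n ≤ m → |∑ i ∈ Finset.Icc n m, s (fan γ i)| ≤ M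

/-- The class `𝒫`: both one-sided sums along every fan converge (conditionally). -/
def classP : Set (Edge → ℝ) :=
  {s | ∀ γ : SL(2, ℤ),
    (∃ l : ℝ, Tendsto (fun n : ℕ => ∑ k ∈ Finset.Icc (-(n : ℤ)) (-1), s (fan γ k)) atTop (𝓝 l)) ∧
    (∃ l : ℝ, Tendsto (fun n : ℕ => ∑ k ∈ Finset.Icc (0 : ℤ) n, s (fan γ k)) atTop (𝓝 l))}

/-- `p_{s,v}(e+)` for `v = γ(∞)` and `e = (γ(∞), γ(0))`: the sum of `s` over the edges after `e` in
the fan of `v`. -/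
def pPlus (s : Edge → ℝ) (γ : SL(2, ℤ)) : ℝ :=
  limUnder atTop fun n : ℕ => ∑ k ∈ Finset.Icc (1 : ℤ) n, s (fan γ k)

/-- `p_{s,v}(e-)` for `v = γ(∞)` and `e = (γ(∞), γ(0))`: the sum of `s` over the edges before `e` in
the fan of `v`. -/
def pMinus (s : Edge → ℝ) (γ : SL(2, ℤ)) : ℝ :=
  limUnder atTop fun n : ℕ => ∑ k ∈ Finset.Icc (-(n : ℤ)) (-1), s (fan γ k)

/-- `(p_{s,a}(e-) - p_{s,a}(e+) + p_{s,b}(e-) - p_{s,b}(e+)) / 4` for the edge `e = (a, b)` with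
`a = γ(∞)` and `b = γ(0)`. Here `γ S` with `S(w) = -1/w` is the reversal of `γ`:
`γ S(∞) = γ(0)` and `γ S(0) = γ(∞)`. -/
def edgeDiamond (s : Edge → ℝ) (γ : SL(2, ℤ)) : ℝ :=
  (pMinus s γ - pPlus s γ +
    pMinus s (γ * ModularGroup.S) - pPlus s (γ * ModularGroup.S)) / 4

/-- The diamond shear coordinate `Ψ(s) : E → ℝ` of `s ∈ 𝒫`. -/
def diamond (s : Edge → ℝ) (e : Edge) : ℝ := edgeDiamond s (frame e)

/-- The class `ℋ` of shear functions with square summable diamond shear coordinate. -/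
def classH : Set (Edge → ℝ) :=
  {s | s ∈ classP ∧ Summable fun e : Edge => diamond s e ^ 2}

/-! ### Independence of the chosen frames -/

lemma cayleyInv_injective : Function.Injective cayleyInv := by
  have key : ∀ x : ℝ, ((x : ℂ) + Complex.I) * (cayleyInv (x : OnePoint ℝ) : ℂ) =
      (x : ℂ) - Complex.I := by
    intro x
    have hx : (x : ℂ) + Complex.I ≠ 0 := fun h => by simpa using congrArg Complex.im h
    simp only [cayleyInv, Circle.ofConjDivSelf]
    change ((x : ℂ) + Complex.I) * ((starRingEnd ℂ) ((x : ℂ) + Complex.I) /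
      ((x : ℂ) + Complex.I)) = _
    rw [mul_div_cancel₀ _ hx]
    simp [sub_eq_add_neg]
  have hne : ∀ x : ℝ, cayleyInv (x : OnePoint ℝ) ≠ 1 := by
    intro x h
    have h1 := key x
    rw [h] at h1
    have := congrArg Complex.im h1
    norm_num at this
  intro v w h
  induction v using OnePoint.rec with
  | infty =>
    induction w using OnePoint.rec with
    | infty => rfl
    | coe x => exact absurd h.symm (hne x)
  | coe y =>
    induction w using OnePoint.rec with
    | infty => exact absurd h (hne y)
    | coe x =>
      have h1 := key x
      have h2 := key y
      rw [h] at h2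
      set z : ℂ := (cayleyInv (x : OnePoint ℝ) : ℂ)
      have h3 : ((y : ℂ) - x) * (z - 1) = 0 := by linear_combination h2 - h1
      rcases mul_eq_zero.mp h3 with h4 | h4
      · have : (y : ℂ) = x := sub_eq_zero.mp h4
        exact_mod_cast congrArg ((↑) : ℝ → OnePoint ℝ) (Complex.ofReal_injective this)
      · exact absurd (Circle.ext (by simpa using sub_eq_zero.mp h4)) (hne x)

lemma pt_eq_of_ends {γ δ : SL(2, ℤ)} (h1 : pt γ ∞ = pt δ ∞)
    (h0 : pt γ ((0 : ℝ) : OnePoint ℝ) = pt δ ((0 : ℝ) : OnePoint ℝ)) : pt γ = pt δ := by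
  have h1' := cayleyInv_injective h1
  have h0' := cayleyInv_injective h0
  obtain ⟨ε, rfl⟩ : ∃ ε, δ = γ * ε := ⟨γ⁻¹ * δ, by simp⟩
  rw [map_mul, mul_smul] at h1' h0'
  have e1' := ((MulAction.injective _) h1').symm
  have e0 := ((MulAction.injective _) h0').symm
  have e1 := e1'
  rw [OnePoint.smul_infty_eq_self_iff] at e1
  have hc : (ε 1 0 : ℤ) = 0 := by simpa using e1
  have hdet := ε.det_coe
  rw [Matrix.det_fin_two, hc, mul_zero, sub_zero] at hdet
  have hd : (ε 1 1 : ℤ) ≠ 0 := fun h => by simp [h] at hdet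
  rw [OnePoint.smul_some_eq_ite] at e0
  have hb : (ε 0 1 : ℤ) = 0 := by
    simpa [hc, hd] using e0
  have had : (ε 0 0 : ℤ) = ε 1 1 := by
    rcases Int.mul_eq_one_iff_eq_one_or_neg_one.mp hdet with h | h <;> rw [h.1, h.2]
  funext w
  rw [pt_mul, pt]
  congr 2
  induction w using OnePoint.rec with
  | infty => exact e1'.symm
  | coe x =>
    rw [OnePoint.smul_some_eq_ite]
    simp [hc, hd, hb, had]

lemma S_infty : (Matrix.SpecialLinearGroup.mapGL ℝ ModularGroup.S) • (∞ : OnePoint ℝ) =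
    ((0 : ℝ) : OnePoint ℝ) := by
  rw [OnePoint.smul_infty_eq_ite]
  simp [mapGL_entry, ModularGroup.coe_S]

lemma S_zero : (Matrix.SpecialLinearGroup.mapGL ℝ ModularGroup.S) • ((0 : ℝ) : OnePoint ℝ) =
    ∞ := by
  rw [OnePoint.smul_some_eq_ite]
  simp [mapGL_entry, ModularGroup.coe_S]

lemma S_coe {x : ℝ} (hx : x ≠ 0) :
    (Matrix.SpecialLinearGroup.mapGL ℝ ModularGroup.S) • (x : OnePoint ℝ) =
      ((-x⁻¹ : ℝ) : OnePoint ℝ) := by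
  rw [OnePoint.smul_some_eq_ite]
  simp [mapGL_entry, ModularGroup.coe_S, hx, neg_div]

lemma pt_eq_of_edge {γ δ : SL(2, ℤ)} (h : fan γ 0 = fan δ 0) :
    pt γ = pt δ ∨ pt γ = pt (δ * ModularGroup.S) := by
  have h' := Sym2.eq_iff.mp (congrArg Subtype.val h)
  simp only [Int.cast_zero] at h'
  rcases h' with ⟨h1, h0⟩ | ⟨h1, h0⟩
  · exact Or.inl (pt_eq_of_ends h1 h0)
  · refine Or.inr (pt_eq_of_ends ?_ ?_)
    · rw [h1, pt_mul, S_infty]; rfl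
    · rw [h0, pt_mul, S_zero]; rfl

lemma pt_mul_congr {γ δ : SL(2, ℤ)} (h : pt γ = pt δ) (ε : SL(2, ℤ)) :
    pt (γ * ε) = pt (δ * ε) := by
  funext w
  rw [pt_mul, pt_mul]
  exact congrFun h _

lemma pt_S_S (γ : SL(2, ℤ)) : pt (γ * ModularGroup.S * ModularGroup.S) = pt γ := by
  refine pt_eq_of_ends ?_ ?_
  · rw [pt_mul, pt, map_mul, mul_smul, S_infty, S_zero]
  · rw [pt_mul, pt, map_mul, mul_smul, S_zero, S_infty]

lemma fan_congr {γ δ : SL(2, ℤ)} (h : pt γ = pt δ) : fan γ = fan δ := by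
  funext n
  exact Subtype.ext (by simp only [fan, h])

lemma frame_spec (e : Edge) : fan (frame e) 0 = e := by
  refine Subtype.ext (Eq.trans ?_ e.2.choose_spec.symm)
  simp only [fan, frame, Int.cast_zero]

lemma cr_reverse (a b c d : ℂ) : cr c d a b = cr a b c d := by
  simp only [cr]
  congr 1 <;> ring

/-- The shear coordinate can be computed in any frame of the edge. -/
lemma shearCoord_fan_zero (h : Circle ≃ₜ Circle) (γ : SL(2, ℤ)) :
    shearCoord h (fan γ 0) = quadShear h γ := by
  have key : ∀ {γ δ : SL(2, ℤ)}, pt γ = pt δ → quadShear h γ = quadShear h δ := fun hp => by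
    simp only [quadShear, hp]
  have rev : ∀ δ : SL(2, ℤ), quadShear h (δ * ModularGroup.S) = quadShear h δ := fun δ => by
    simp only [quadShear, pt_mul, S_infty, S_zero, S_coe (show (1 : ℝ) ≠ 0 by norm_num),
      S_coe (show (-1 : ℝ) ≠ 0 by norm_num), shear]
    rw [← cr_reverse]
    norm_num [pt]
  rcases pt_eq_of_edge (frame_spec (fan γ 0)) with hp | hp
  · exact key hp
  · exact (key hp).trans (rev γ)

/-- The diamond shear coordinate can be computed in any frame of the edge. -/
lemma diamond_fan_zero (s : Edge → ℝ) (γ : SL(2, ℤ)) :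
    diamond s (fan γ 0) = edgeDiamond s γ := by
  have key : ∀ {γ δ : SL(2, ℤ)}, pt γ = pt δ → edgeDiamond s γ = edgeDiamond s δ := fun hp => by
    simp only [edgeDiamond, pPlus, pMinus, fan_congr hp,
      fan_congr (pt_mul_congr hp ModularGroup.S)]
  have rev : ∀ δ : SL(2, ℤ), edgeDiamond s (δ * ModularGroup.S) = edgeDiamond s δ := fun δ => by
    simp only [edgeDiamond, pPlus, pMinus, fan_congr (pt_S_S δ)]
    ring
  rcases pt_eq_of_edge (frame_spec (fan γ 0)) with hp | hp
  · exact key hp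
  · exact (key hp).trans (rev γ)

end FareyShear

end

/-! Quasisymmetry. In half-plane charts that put `γ(∞)` and its image at infinity, `h` is an
increasing function `F` of the line. The shears of the fan of `γ(∞)` are the logarithms of the
ratios of consecutive lengths `F (n + 1) - F n`, so bounded fan sums make all these lengths
comparable; the single shears of `(n, n + 1)`, `(n, n + 1/2)` and `(n + 1/2, n + 1)` control the
subdivision at `1/2`, `1/3`, `2/3` (`chart_fareyDistortion`). Hence `F` is bi-Lipschitz at distances
at least `0.7`, up to one scale factor and with constants that do not depend on the chart
(`FareyDistortion.bilipschitz`). The points of angles `x + π`, `x - t`, `x`, `x + t` have cross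
ratio of modulus one. Moving the crossing point of the two diagonals of this quadruple into the
fundamental domain of `SL(2, ℤ)` gives a chart in which cyclic neighbours are at least `0.7` apart
(`exists_quad_coords`), so the cross ratio of the images is bounded. For `t ≤ π / 2` the two chords
that end at the image of `x + π` are bounded below by compactness, and what remains of the cross
ratio is the quasisymmetry quotient.

Uniqueness. Three corners of a Farey quad and its shear determine the fourth. Starting from the
three normalized points and moving through the tessellation, two homeomorphisms with the same shears
agree at all vertices, and these are dense.

Existence. The shears prescribe the images of the rational points: `dev` is built by recursion along
the Farey tree, is strictly increasing, and transforms by Möbius maps under the generators `S` and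
`T` (`dev_neg_inv`, `dev_add_one`). What needs the bound on fan sums is that its range is dense. By
renormalization, a gap `(α, β)` of the range with `α > 0` produces a gap in another frame whose
relative size `(β - α) / β` is larger by a fixed factor (`IsGap.exists_larger`); relative sizes are
at most one, so there is no gap. A strictly increasing function on `ℚ` with dense range extends to
an order isomorphism of `ℝ`, hence to a circle homeomorphism.

The class `ℋ`. Square summability bounds the diamond shears. Write `q = p(e-) - p(e+)` at an
endpoint of `e`. Combining the diamond shears of the three sides of a Farey triangle isolates `q +
s(e)`, which is therefore bounded, and twice a fan sum is a difference of two such quantities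
(`fanSumsBounded_of_edgeDiamond_le`). So part (1) applies. -/

namespace FareyShear

/-! ### Homogeneous coordinates on the circle -/

/-- The point of the unit circle that corresponds to the point `p / q` of `ℝ ∪ {∞}`. -/
noncomputable def homPt (p q : ℝ) : ℂ := (p - q * Complex.I) / (p + q * Complex.I)

lemma homPt_den_ne_zero {p q : ℝ} (h : p ≠ 0 ∨ q ≠ 0) : (p : ℂ) + q * Complex.I ≠ 0 := by
  intro h0
  have h1 := congrArg Complex.re h0
  have h2 := congrArg Complex.im h0
  simp at h1 h2
  tauto

lemma homPt_smul {k : ℝ} (hk : k ≠ 0) (p q : ℝ) : homPt (k * p) (k * q) = homPt p q := by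
  have hk' : (k : ℂ) ≠ 0 := by exact_mod_cast hk
  unfold homPt
  push_cast
  rw [show (k : ℂ) * p - k * q * Complex.I = k * (p - q * Complex.I) by ring,
    show (k : ℂ) * p + k * q * Complex.I = k * (p + q * Complex.I) by ring,
    mul_div_mul_left _ _ hk']

lemma cayleyInv_infty : (cayleyInv ∞ : ℂ) = homPt 1 0 := by
  change ((1 : Circle) : ℂ) = _
  simp [homPt]

lemma cayleyInv_coe (x : ℝ) : (cayleyInv (x : OnePoint ℝ) : ℂ) = homPt x 1 := by
  change (starRingEnd ℂ) ((x : ℂ) + Complex.I) / ((x : ℂ) + Complex.I) = _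
  simp [homPt, sub_eq_add_neg]

lemma cayleyInv_div (p : ℝ) {q : ℝ} (hq : q ≠ 0) :
    (cayleyInv ((p / q : ℝ) : OnePoint ℝ) : ℂ) = homPt p q := by
  rw [cayleyInv_coe, ← homPt_smul hq]
  field_simp

/-- Chords become determinants of homogeneous coordinates. The complex denominators cancel in every
cross ratio. -/
lemma homPt_sub {p q p' q' : ℝ} (h : p ≠ 0 ∨ q ≠ 0) (h' : p' ≠ 0 ∨ q' ≠ 0) :
    homPt p q - homPt p' q' = 2 * Complex.I * ((p * q' - p' * q : ℝ) : ℂ) /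
      ((p + q * Complex.I) * (p' + q' * Complex.I)) := by
  rw [homPt, homPt, div_sub_div _ _ (homPt_den_ne_zero h) (homPt_den_ne_zero h')]
  congr 1
  push_cast
  ring

lemma pt_infty (γ : SL(2, ℤ)) : (pt γ ∞ : ℂ) = homPt (γ 0 0) (γ 1 0) := by
  rw [pt, OnePoint.smul_infty_eq_ite]
  simp only [mapGL_entry]
  split_ifs with h
  · have h0 : (γ 1 0 : ℤ) = 0 := by exact_mod_cast h
    have hdet := γ.det_coe
    rw [Matrix.det_fin_two, h0, mul_zero, sub_zero] at hdet
    have ha : ((γ 0 0 : ℤ) : ℝ) ≠ 0 := by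
      intro ha
      have : (γ 0 0 : ℤ) = 0 := by exact_mod_cast ha
      simp [this] at hdet
    rw [cayleyInv_infty, ← homPt_smul ha, h]
    simp
  · exact cayleyInv_div _ h

lemma pt_coe (γ : SL(2, ℤ)) (x : ℝ) :
    (pt γ (x : OnePoint ℝ) : ℂ) = homPt (γ 0 0 * x + γ 0 1) (γ 1 0 * x + γ 1 1) := by
  rw [pt, OnePoint.smul_some_eq_ite]
  simp only [mapGL_entry]
  split_ifs with h
  · have hdet := γ.det_coe
    rw [Matrix.det_fin_two] at hdet
    have hdet' : ((γ 0 0 : ℤ) : ℝ) * (γ 1 1 : ℤ) - (γ 0 1 : ℤ) * (γ 1 0 : ℤ) = 1 := by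
      exact_mod_cast hdet
    have ha : ((γ 0 0 : ℤ) : ℝ) * x + (γ 0 1 : ℤ) ≠ 0 := by
      intro ha
      have h1 : ((γ 0 0 : ℤ) : ℝ) *  (((γ 1 0 : ℤ) : ℝ) * x + (γ 1 1 : ℤ)) = 0 := by rw [h, mul_zero]
      have h2 : ((γ 1 0 : ℤ) : ℝ) *  (((γ 0 0 : ℤ) : ℝ) * x + (γ 0 1 : ℤ)) = 0 := by rw [ha, mul_zero]
      linarith
    rw [cayleyInv_infty, ← homPt_smul ha, h]
    simp
  · exact cayleyInv_div _ h

lemma pt_mul_infty (γ δ : SL(2, ℤ)) : pt (γ * δ) ∞ =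
    pt γ (if (δ 1 0 : ℝ) = 0 then ∞ else ((δ 0 0 / δ 1 0 : ℝ) : OnePoint ℝ)) := by
  rw [pt_mul, OnePoint.smul_infty_eq_ite]
  simp only [mapGL_entry]
  rfl

lemma pt_mul_coe (γ δ : SL(2, ℤ)) (x : ℝ) : pt (γ * δ) (x : OnePoint ℝ) =
    pt γ (if (δ 1 0 * x + δ 1 1 : ℝ) = 0 then ∞ else
      (((δ 0 0 * x + δ 0 1) / (δ 1 0 * x + δ 1 1) : ℝ) : OnePoint ℝ)) := by
  rw [pt_mul, OnePoint.smul_some_eq_ite]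
  simp only [mapGL_entry]
  rfl

lemma pt_injective (γ : SL(2, ℤ)) : Function.Injective (pt γ) :=
  cayleyInv_injective.comp (MulAction.injective _)

lemma cr_homPt {a a' b b' c c' d d' : ℝ} (ha : a ≠ 0 ∨ a' ≠ 0) (hb : b ≠ 0 ∨ b' ≠ 0)
    (hc : c ≠ 0 ∨ c' ≠ 0) (hd : d ≠ 0 ∨ d' ≠ 0) :
    cr (homPt a a') (homPt b b') (homPt c c') (homPt d d') =
      (((b * a' - a * b') * (d * c' - c * d') / ((c * b' - b * c') * (d * a' - a * d')) : ℝ) : ℂ) := by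
  rw [cr, homPt_sub hb ha, homPt_sub hd hc, homPt_sub hc hb, homPt_sub hd ha]
  have ha := homPt_den_ne_zero ha
  have hb := homPt_den_ne_zero hb
  have hc := homPt_den_ne_zero hc
  have hd := homPt_den_ne_zero hd
  have hI := Complex.I_ne_zero
  rw [div_mul_div_comm, div_mul_div_comm]
  set A := (a : ℂ) + a' * Complex.I
  set B := (b : ℂ) + b' * Complex.I
  set C := (c : ℂ) + c' * Complex.I
  set D := (d : ℂ) + d' * Complex.I
  rw [show C * B * (D * A) = B * A * (D * C) by ring, div_div_div_cancel_right₀ (by positivity),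
    mul_mul_mul_comm, mul_mul_mul_comm (2 * Complex.I) _ (2 * Complex.I),
    mul_div_mul_left _ _ (by simp)]
  push_cast
  rfl

lemma cr_mul_left {v : ℂ} (hv : v ≠ 0) (a b c d : ℂ) :
    cr (v * a) (v * b) (v * c) (v * d) = cr a b c d := by
  simp only [cr, ← mul_sub]
  rw [mul_mul_mul_comm, mul_mul_mul_comm v _ v, mul_div_mul_left _ _ (mul_ne_zero hv hv)]

/-- The real part of the complex logarithm sees only the modulus, so the positivity of the cross
ratio is never needed to evaluate a shear. -/
lemma shear_eq (a b c d : Circle) : shear a b c d = Real.log ‖cr a b c d‖ := by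
  rw [shear, Complex.log_re]

lemma cr_mul_homPt (v : Circle) {a a' b b' c c' d d' : ℝ} (ha : a ≠ 0 ∨ a' ≠ 0)
    (hb : b ≠ 0 ∨ b' ≠ 0) (hc : c ≠ 0 ∨ c' ≠ 0) (hd : d ≠ 0 ∨ d' ≠ 0) {z₁ z₂ z₃ z₄ : Circle}
    (h₁ : (z₁ : ℂ) = v * homPt a a') (h₂ : (z₂ : ℂ) = v * homPt b b')
    (h₃ : (z₃ : ℂ) = v * homPt c c') (h₄ : (z₄ : ℂ) = v * homPt d d') :
    ‖cr z₁ z₂ z₃ z₄‖ =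
      |(b * a' - a * b') * (d * c' - c * d') / ((c * b' - b * c') * (d * a' - a * d'))| := by
  rw [h₁, h₂, h₃, h₄, cr_mul_left v.coe_ne_zero, cr_homPt ha hb hc hd, Complex.norm_real,
    Real.norm_eq_abs]

/-! ### Cyclic order -/

/-- The points `a`, `b`, `c` of the circle are distinct and in counterclockwise order. -/
def Ccw (a b c : Circle) : Prop :=
  (((a : ℂ) - b) * (b - c) * (c - a) / (a * b * c)).im < 0

lemma ccw_mul_left (v a b c : Circle) : Ccw (v * a) (v * b) (v * c) ↔ Ccw a b c := by
  have hv := v.coe_ne_zero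
  unfold Ccw
  simp only [Circle.coe_mul, ← mul_sub]
  rw [show (v : ℂ) * (a - b) * (v * (b - c)) * (v * (c - a)) =
    (v ^ 3) * ((a - b) * (b - c) * (c - a)) by ring,
    show (v : ℂ) * a * (v * b) * (v * c) = v ^ 3 * (a * b * c) by ring,
    mul_div_mul_left _ _ (pow_ne_zero 3 hv)]

/-- Since `homPt s t` is `|w|² / w²` with `w = s + t i`, the complex denominators of the three
differences cancel against `a b c`. What is left is `-8 i` times the product of determinants over a
positive number. -/
lemma ccw_iff_of_homPt {a b c : Circle} {p p' q q' r r' : ℝ} (hp : p ≠ 0 ∨ p' ≠ 0)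
    (hq : q ≠ 0 ∨ q' ≠ 0) (hr : r ≠ 0 ∨ r' ≠ 0) (ha : (a : ℂ) = homPt p p')
    (hb : (b : ℂ) = homPt q q') (hc : (c : ℂ) = homPt r r') :
    Ccw a b c ↔ 0 < (p * q' - q * p') * (q * r' - r * q') * (r * p' - p * r') := by
  have key : ((a : ℂ) - b) * (b - c) * (c - a) / (a * b * c) = Complex.I *
      ((-8 * ((p * q' - q * p') * (q * r' - r * q') * (r * p' - p * r')) /
        ((p ^ 2 + p' ^ 2) * (q ^ 2 + q' ^ 2) * (r ^ 2 + r' ^ 2)) : ℝ) : ℂ) := by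
    rw [ha, hb, hc, homPt_sub hp hq, homPt_sub hq hr, homPt_sub hr hp]
    have h : ∀ s t : ℝ, (s ≠ 0 ∨ t ≠ 0) → homPt s t * (s + t * Complex.I) ^ 2 = (s ^ 2 + t ^ 2 : ℝ)
        ∧ ((s ^ 2 + t ^ 2 : ℝ) : ℂ) ≠ 0 := by
      intro s t hst
      constructor
      · rw [homPt, pow_two, ← mul_assoc, div_mul_cancel₀ _ (homPt_den_ne_zero hst)]
        push_cast
        linear_combination -(t : ℂ) ^ 2 * Complex.I_sq
      · have : s ^ 2 + t ^ 2 ≠ 0 := by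
          rcases hst with h | h <;> positivity
        exact_mod_cast this
    obtain ⟨h1, n1⟩ := h p p' hp
    obtain ⟨h2, n2⟩ := h q q' hq
    obtain ⟨h3, n3⟩ := h r r' hr
    have hp := homPt_den_ne_zero hp
    have hq := homPt_den_ne_zero hq
    have hr := homPt_den_ne_zero hr
    set A := (p : ℂ) + p' * Complex.I
    set B := (q : ℂ) + q' * Complex.I
    set C := (r : ℂ) + r' * Complex.I
    have h1' := eq_div_of_mul_eq (pow_ne_zero 2 hp) h1
    have h2' := eq_div_of_mul_eq (pow_ne_zero 2 hq) h2
    have h3' := eq_div_of_mul_eq (pow_ne_zero 2 hr) h3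
    rw [h1', h2', h3', Complex.ofReal_div, Complex.ofReal_mul, Complex.ofReal_mul,
      Complex.ofReal_mul, Complex.ofReal_mul, Complex.ofReal_mul]
    set u := ((p ^ 2 + p' ^ 2 : ℝ) : ℂ)
    set v := ((q ^ 2 + q' ^ 2 : ℝ) : ℂ)
    set w := ((r ^ 2 + r' ^ 2 : ℝ) : ℂ)
    have hI := Complex.I_sq
    field_simp
    rw [hI]
    push_cast
    ring
  have hpos : ∀ s t : ℝ, (s ≠ 0 ∨ t ≠ 0) → 0 < s ^ 2 + t ^ 2 := by
    intro s t h
    rcases h with h | h <;> positivity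
  have := hpos p p' hp
  have := hpos q q' hq
  have := hpos r r' hr
  rw [Ccw, key, Complex.I_mul_im, Complex.ofReal_re, div_lt_iff₀ (by positivity), zero_mul]
  constructor <;> intro h <;> linarith

lemma ccw_infty_iff (x y : ℝ) : Ccw (cayleyInv ∞) (cayleyInv x) (cayleyInv y) ↔ x < y := by
  rw [ccw_iff_of_homPt (by simp) (by simp) (by simp) cayleyInv_infty (cayleyInv_coe x)
    (cayleyInv_coe y)]
  constructor <;> intro h <;> linarith

lemma ccw_pt_infty_iff (γ : SL(2, ℤ)) (x y : ℝ) : Ccw (pt γ ∞) (pt γ x) (pt γ y) ↔ x < y := by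
  have hdet := γ.det_coe
  rw [Matrix.det_fin_two] at hdet
  have hdet' : ((γ 0 0 : ℤ) : ℝ) * (γ 1 1 : ℤ) - (γ 0 1 : ℤ) * (γ 1 0 : ℤ) = 1 := by
    exact_mod_cast hdet
  have hne : ∀ z : ℝ, (γ 0 0 : ℝ) * z + γ 0 1 ≠ 0 ∨ (γ 1 0 : ℝ) * z + γ 1 1 ≠ 0 := by
    intro z
    by_contra! h
    have : (γ 0 0 : ℝ) * ((γ 1 0 : ℝ) * z + γ 1 1) - (γ 1 0 : ℝ) * ((γ 0 0 : ℝ) * z + γ 0 1) = 0 := by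
      rw [h.1, h.2]; ring
    linarith
  have h0 : (γ 0 0 : ℝ) ≠ 0 ∨ (γ 1 0 : ℝ) ≠ 0 := by
    by_contra! h
    rw [h.1, h.2] at hdet'
    simp at hdet'
  rw [ccw_iff_of_homPt h0 (hne x) (hne y) (pt_infty γ) (pt_coe γ x) (pt_coe γ y)]
  set a := ((γ 0 0 : ℤ) : ℝ)
  set b := ((γ 0 1 : ℤ) : ℝ)
  set c := ((γ 1 0 : ℤ) : ℝ)
  set d := ((γ 1 1 : ℤ) : ℝ)
  rw [show a * (c * x + d) - (a * x + b) * c = a * d - b * c by ring,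
    show (a * x + b) * (c * y + d) - (a * y + b) * (c * x + d) = (a * d - b * c) * (x - y) by ring,
    show (a * y + b) * c - a * (c * y + d) = - (a * d - b * c) by ring, hdet']
  constructor <;> intro h <;> linarith

lemma exp_eq_homPt (θ : ℝ) :
    (Circle.exp θ : ℂ) = homPt (Real.cos (θ / 2)) (-Real.sin (θ / 2)) := by
  have h1 : (Real.cos (θ / 2) : ℂ) - (-Real.sin (θ / 2) : ℝ) * Complex.I =
      Complex.exp ((θ / 2 : ℝ) * Complex.I) := by
    rw [Complex.exp_ofReal_mul_I]; push_cast; ring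
  have h2 : (Real.cos (θ / 2) : ℂ) + (-Real.sin (θ / 2) : ℝ) * Complex.I =
      Complex.exp (-((θ / 2 : ℝ) * Complex.I)) := by
    rw [← neg_mul, ← Complex.ofReal_neg, Complex.exp_ofReal_mul_I, Real.cos_neg, Real.sin_neg]
  rw [homPt, h1, h2, ← Complex.exp_sub, Circle.coe_exp]
  congr 1
  push_cast
  ring

lemma cos_ne_zero_or_neg_sin_ne_zero (x : ℝ) : Real.cos x ≠ 0 ∨ -Real.sin x ≠ 0 := by
  by_contra! h
  have := Real.sin_sq_add_cos_sq x
  rw [h.1, neg_eq_zero.mp h.2] at this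
  simp at this

lemma ccw_exp_iff (α β γ : ℝ) : Ccw (Circle.exp α) (Circle.exp β) (Circle.exp γ) ↔
    0 < Real.sin ((β - α) / 2) * Real.sin ((γ - β) / 2) * Real.sin ((α - γ) / 2) * (-1) := by
  rw [ccw_iff_of_homPt (cos_ne_zero_or_neg_sin_ne_zero _) (cos_ne_zero_or_neg_sin_ne_zero _)
    (cos_ne_zero_or_neg_sin_ne_zero _) (exp_eq_homPt α) (exp_eq_homPt β) (exp_eq_homPt γ)]
  rw [sub_div, sub_div, sub_div, Real.sin_sub, Real.sin_sub, Real.sin_sub]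
  ring_nf

lemma ccw_exp_of_lt {α β γ : ℝ} (h₁ : α < β) (h₂ : β < γ) (h₃ : γ < α + 2 * Real.pi) :
    Ccw (Circle.exp α) (Circle.exp β) (Circle.exp γ) := by
  rw [ccw_exp_iff, show (α - γ) / 2 = -((γ - α) / 2) by ring, Real.sin_neg]
  have := Real.sin_pos_of_pos_of_lt_pi (x := (β - α) / 2) (by linarith) (by linarith)
  have := Real.sin_pos_of_pos_of_lt_pi (x := (γ - β) / 2) (by linarith) (by linarith)
  have := Real.sin_pos_of_pos_of_lt_pi (x := (γ - α) / 2) (by linarith) (by linarith)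
  have h : 0 < Real.sin ((β - α) / 2) * Real.sin ((γ - β) / 2) * Real.sin ((γ - α) / 2) := by
    positivity
  linarith

lemma Ccw.exists_lift {a b c : Circle} (h : Ccw a b c) : ∃ α β γ : ℝ, Circle.exp α = a ∧
    Circle.exp β = b ∧ Circle.exp γ = c ∧ α < β ∧ β < γ ∧ γ < α + 2 * Real.pi := by
  have hab : a ≠ b := by rintro rfl; simp [Ccw] at h
  have hac : a ≠ c := by rintro rfl; simp [Ccw] at h
  obtain ⟨α, rfl⟩ := Circle.exp_surjective a
  have hb := Circle.angleDiff_pos hab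
  have hc := Circle.angleDiff_pos hac
  have hb2 := Circle.angleDiff_lt_two_pi (Circle.exp α) b
  have hc2 := Circle.angleDiff_lt_two_pi (Circle.exp α) c
  have eb : Circle.exp (α + Circle.angleDiff (Circle.exp α) b) = b := by
    rw [add_comm, Circle.exp_add, Circle.exp_angleDiff_mul]
  have ec : Circle.exp (α + Circle.angleDiff (Circle.exp α) c) = c := by
    rw [add_comm, Circle.exp_add, Circle.exp_angleDiff_mul]
  refine ⟨α, _, _, rfl, eb, ec, by linarith, ?_, by linarith⟩
  set β := α + Circle.angleDiff (Circle.exp α) b with hβ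
  set γ := α + Circle.angleDiff (Circle.exp α) c with hγ
  rw [← eb, ← ec, ccw_exp_iff] at h
  by_contra! hle
  rcases hle.lt_or_eq with hlt | heq
  · rw [show (γ - β) / 2 = -((β - γ) / 2) by ring, show (α - γ) / 2 = -((γ - α) / 2) by ring,
      Real.sin_neg, Real.sin_neg] at h
    have := Real.sin_pos_of_pos_of_lt_pi (x := (β - α) / 2) (by linarith) (by linarith)
    have := Real.sin_pos_of_pos_of_lt_pi (x := (β - γ) / 2) (by linarith) (by linarith)
    have := Real.sin_pos_of_pos_of_lt_pi (x := (γ - α) / 2) (by linarith) (by linarith)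
    have h : 0 < Real.sin ((β - α) / 2) * Real.sin ((β - γ) / 2) * Real.sin ((γ - α) / 2) := by
      positivity
    linarith
  · rw [heq] at h
    simp at h

lemma OrientationPreserving.ccw {h : Circle ≃ₜ Circle} (ho : OrientationPreserving h)
    {a b c : Circle} (habc : Ccw a b c) : Ccw (h a) (h b) (h c) := by
  obtain ⟨f, fc, fm, hf⟩ := ho
  obtain ⟨α, β, γ, rfl, rfl, rfl, h1, h2, h3⟩ := habc.exists_lift
  rw [hf, hf, hf]
  refine ccw_exp_of_lt (fm h1) (fm h2) ?_
  by_contra! hle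
  -- If the lift advanced by `2π` or more between `α` and `γ`, it would take the value `f α + 2π` in
  -- between, and `h` would identify two points less than a full turn apart.
  obtain ⟨x, ⟨hx1, hx2⟩, hx⟩ := intermediate_value_Icc (h1.trans h2).le fc.continuousOn
    (show f α + 2 * Real.pi ∈ Set.Icc (f α) (f γ) from ⟨by linarith [Real.pi_pos], hle⟩)
  have e : h (Circle.exp x) = h (Circle.exp α) := by
    rw [hf, hf, hx, Circle.exp_add_two_pi]
  have e' := Circle.exp_injOn_Ico (a := α) (b := α + 2 * Real.pi) (by linarith)
    ⟨hx1, by linarith⟩ ⟨le_rfl, by linarith [Real.pi_pos]⟩ (h.injective e)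
  rw [e'] at hx
  linarith [Real.pi_pos]

/-! ### Half-plane charts of circle homeomorphisms -/

lemma cayleyInv_surjective : Function.Surjective cayleyInv := by
  intro z
  obtain ⟨θ, rfl⟩ := Circle.exp_surjective z
  by_cases hs : -Real.sin (θ / 2) = 0
  · refine ⟨∞, Circle.ext ?_⟩
    have hc := (cos_ne_zero_or_neg_sin_ne_zero (θ / 2)).resolve_right (not_not.mpr hs)
    rw [cayleyInv_infty, exp_eq_homPt, hs, ← homPt_smul hc]
    simp
  · exact ⟨_, Circle.ext ((cayleyInv_div _ hs).trans (exp_eq_homPt θ).symm)⟩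

/-- In the coordinates that send `γ(∞)` and its image to `∞`, an orientation-preserving
homeomorphism of the circle is a strictly increasing function. -/
lemma OrientationPreserving.exists_chart {h : Circle ≃ₜ Circle} (ho : OrientationPreserving h)
    (γ : SL(2, ℤ)) : ∃ F : ℝ → ℝ, StrictMono F ∧
      ∀ x : ℝ, h (pt γ x) = h (pt γ ∞) * cayleyInv (F x) := by
  have hex : ∀ x : ℝ, ∃ y : ℝ, h (pt γ x) = h (pt γ ∞) * cayleyInv y := by
    intro x
    obtain ⟨w, hw⟩ := cayleyInv_surjective ((h (pt γ ∞))⁻¹ * h (pt γ x))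
    induction w using OnePoint.rec with
    | infty =>
      have h1 : cayleyInv ∞ = 1 := rfl
      rw [h1, eq_comm, inv_mul_eq_one] at hw
      have := pt_injective γ (h.injective hw)
      simp at this
    | coe y => exact ⟨y, by rw [hw, mul_inv_cancel_left]⟩
  choose F hF using hex
  refine ⟨F, fun x y hxy => ?_, hF⟩
  have := ho.ccw ((ccw_pt_infty_iff γ x y).mpr hxy)
  rw [hF, hF, ← mul_one (h (pt γ ∞)), mul_assoc, mul_assoc, one_mul, one_mul, ccw_mul_left] at this
  exact (ccw_infty_iff _ _).mp this

end FareyShear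

namespace FareyShear

/-! ### Shears in a chart -/

lemma fan_eq_fan_zero (γ : SL(2, ℤ)) (n : ℤ) : fan γ n = fan (γ * ModularGroup.T ^ n) 0 := by
  refine Subtype.ext ?_
  simp only [fan, pt_mul, T_zpow_infty, T_zpow_coe]
  simp [pt]

lemma pt_mul_T_zpow_infty (γ : SL(2, ℤ)) (n : ℤ) : pt (γ * ModularGroup.T ^ n) ∞ = pt γ ∞ := by
  rw [pt_mul, T_zpow_infty, pt]

lemma pt_mul_T_zpow_coe (γ : SL(2, ℤ)) (n : ℤ) (x : ℝ) :
    pt (γ * ModularGroup.T ^ n) x = pt γ ((x + n : ℝ) : OnePoint ℝ) := by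
  rw [pt_mul, T_zpow_coe, pt]

lemma shearCoord_fan (h : Circle ≃ₜ Circle) (γ : SL(2, ℤ)) (n : ℤ) :
    shearCoord h (fan γ n) = quadShear h (γ * ModularGroup.T ^ n) := by
  rw [fan_eq_fan_zero, shearCoord_fan_zero]

/-- The corner at infinity cancels from the cross ratio, which becomes the ratio of two adjacent
image lengths. This is why shears telescope along a fan. -/
lemma quadShear_mul_T_zpow {h : Circle ≃ₜ Circle} {γ : SL(2, ℤ)} {F : ℝ → ℝ} {v : Circle}
    (hv : h (pt γ ∞) = v) (hF : ∀ x : ℝ, h (pt γ x) = v * cayleyInv (F x)) (n : ℤ) :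
    quadShear h (γ * ModularGroup.T ^ n) =
      Real.log ((F (n + 1) - F n) / (F n - F (n - 1))) := by
  have hF' : ∀ x : ℝ, (h (pt γ x) : ℂ) = v * homPt (F x) 1 := fun x => by
    rw [hF, Circle.coe_mul, cayleyInv_coe]
  rw [quadShear, pt_mul_T_zpow_infty, pt_mul_T_zpow_coe, pt_mul_T_zpow_coe, pt_mul_T_zpow_coe,
    shear_eq, cr_mul_homPt v (a := 1) (a' := 0) (by simp) (by simp) (by simp) (by simp)
      (by rw [hv, ← cayleyInv_infty]; exact (mul_one _).symm) (hF' _) (hF' _) (hF' _),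
    Real.log_abs]
  congr 1
  rw [show (-1 : ℝ) + n = n - 1 by ring, zero_add, add_comm (1 : ℝ) n]
  simp only [mul_zero, mul_one, zero_sub]
  rw [mul_neg_one, neg_one_mul, neg_div_neg_eq]

/-- With finite values separated from `∞`, the corners of an explicit Farey quad can be read off
from the entries of the matrix. -/
lemma exists_pt_mul (γ : SL(2, ℤ)) {a b c d : ℤ} (hdet : a * d - b * c = 1) : ∃ δ : SL(2, ℤ),
    (∀ x y : ℝ, (c : ℝ) * x + d ≠ 0 → (a * x + b) / (c * x + d) = y → pt (γ * δ) x = pt γ y) ∧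
    (∀ x : ℝ, (c : ℝ) * x + d = 0 → pt (γ * δ) x = pt γ ∞) ∧
    (∀ y : ℝ, (c : ℝ) ≠ 0 → (a / c : ℝ) = y → pt (γ * δ) ∞ = pt γ y) := by
  refine ⟨⟨!![a, b; c, d], by rw [Matrix.det_fin_two_of, hdet]⟩, ?_, ?_, ?_⟩
  · rintro x y h rfl
    exact (pt_mul_coe _ _ _).trans (congrArg _ (if_neg h))
  · intro x h
    exact (pt_mul_coe _ _ _).trans (congrArg _ (if_pos h))
  · rintro y h rfl
    exact (pt_mul_infty _ _).trans (congrArg _ (if_neg h))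

lemma le_exp_mul_of_abs_log_le {N D M : ℝ} (hN : 0 < N) (hD : 0 < D)
    (h : |Real.log (N / D)| ≤ M) : N ≤ Real.exp M * D ∧ D ≤ Real.exp M * N := by
  rw [Real.log_div hN.ne' hD.ne', abs_le] at h
  constructor
  · rw [← Real.log_le_log_iff hN (by positivity), Real.log_mul (Real.exp_pos M).ne' hD.ne',
      Real.log_exp]
    linarith
  · rw [← Real.log_le_log_iff hD (by positivity), Real.log_mul (Real.exp_pos M).ne' hN.ne',
      Real.log_exp]
    linarith

/-! ### Strictly increasing functions with bounded Farey distortion -/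

/-- The images under `F` of the unit intervals with integral endpoints have comparable lengths, and
the subdivisions at `1/2`, `1/3`, `2/3` have bounded distortion. -/
structure FareyDistortion (K : ℝ) (F : ℝ → ℝ) : Prop where
  strictMono : StrictMono F
  gap : ∀ m n : ℤ, F (m + 1) - F m ≤ K * (F (n + 1) - F n)
  half : ∀ n : ℤ, F (n + 1 / 2) - F n ≤ K * (F (n + 1) - F (n + 1 / 2)) ∧
    F (n + 1) - F (n + 1 / 2) ≤ K * (F (n + 1 / 2) - F n)
  third : ∀ n : ℤ, (F (n + 1 / 3) - F n) * (F (n + 1) - F (n + 1 / 2)) ≤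
      K * ((F (n + 1 / 2) - F (n + 1 / 3)) * (F (n + 1) - F n)) ∧
    (F (n + 1 / 2) - F (n + 1 / 3)) * (F (n + 1) - F n) ≤
      K * ((F (n + 1 / 3) - F n) * (F (n + 1) - F (n + 1 / 2)))
  two_thirds : ∀ n : ℤ, (F (n + 2 / 3) - F (n + 1 / 2)) * (F (n + 1) - F n) ≤
      K * ((F (n + 1) - F (n + 2 / 3)) * (F (n + 1 / 2) - F n))

lemma chart_fareyDistortion {h : Circle ≃ₜ Circle} {M : ℝ}
    (hM : ∀ (γ : SL(2, ℤ)) (n m : ℤ), n ≤ m →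
      |∑ i ∈ Finset.Icc n m, shearCoord h (fan γ i)| ≤ M)
    {γ : SL(2, ℤ)} {F : ℝ → ℝ} (hm : StrictMono F)
    (hF : ∀ x : ℝ, h (pt γ x) = h (pt γ ∞) * cayleyInv (F x)) :
    FareyDistortion (Real.exp M) F := by
  set v := h (pt γ ∞) with hv
  have hF' : ∀ x : ℝ, (h (pt γ x) : ℂ) = v * homPt (F x) 1 := fun x => by
    rw [hF, Circle.coe_mul, cayleyInv_coe]
  have hFinf : (h (pt γ ∞) : ℂ) = v * homPt 1 0 := by
    rw [← hv, ← cayleyInv_infty]; exact (mul_one _).symm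
  have hq : ∀ δ : SL(2, ℤ), |quadShear h δ| ≤ M := by
    intro δ
    have := hM δ 0 0 le_rfl
    rwa [Finset.Icc_self, Finset.sum_singleton, shearCoord_fan_zero] at this
  have hpos : ∀ n : ℤ, 0 < F (n + 1) - F n := fun n => sub_pos.mpr (hm (lt_add_one _))
  have h1 : ∀ n : ℤ, F n < F (n + 1 / 3) := fun n => hm (by linarith)
  have h2 : ∀ n : ℤ, F (n + 1 / 3) < F (n + 1 / 2) := fun n => hm (by linarith)
  have h3 : ∀ n : ℤ, F (n + 1 / 2) < F (n + 2 / 3) := fun n => hm (by linarith)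
  have h4 : ∀ n : ℤ, F (n + 2 / 3) < F (n + 1) := fun n => hm (by linarith)
  refine ⟨hm, ?_, ?_, ?_, ?_⟩
  -- The sum of the shears of the edges `n + 1, …, m` telescopes to the logarithm of the ratio of
  -- the lengths over `[m, m + 1]` and `[n, n + 1]`.
  · have key : ∀ n m : ℤ, n ≤ m → |Real.log (F (m + 1) - F m) - Real.log (F (n + 1) - F n)| ≤ M := by
      intro n m hnm
      rcases hnm.eq_or_lt with rfl | hlt
      · simpa using (abs_nonneg _).trans (hq 1)
      have hs : ∀ k : ℤ, n + 1 ≤ k → ∑ i ∈ Finset.Icc (n + 1) k, shearCoord h (fan γ i) =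
          Real.log (F (k + 1) - F k) - Real.log (F (n + 1) - F n) := by
        have hstep : ∀ k : ℤ, shearCoord h (fan γ k) =
            Real.log (F (k + 1) - F k) - Real.log (F k - F (k - 1)) := by
          intro k
          have := hpos (k - 1)
          push_cast at this
          rw [sub_add_cancel] at this
          rw [shearCoord_fan, quadShear_mul_T_zpow hv.symm hF,
            Real.log_div (hpos k).ne' this.ne']
        intro k hk
        induction k, hk using Int.leInduction with
        | base =>
          rw [Finset.Icc_self, Finset.sum_singleton, hstep]
          push_cast
          rw [add_sub_cancel_right]
        | succ k hk ih =>
          rw [← Finset.insert_Icc_right_eq_Icc_add_one (by omega), Finset.sum_insert (by simp), ih, hstep]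
          push_cast
          rw [add_sub_cancel_right]
          ring
      rw [← hs m (by omega)]
      exact hM γ _ _ (by omega)
    intro m n
    have hb : |Real.log ((F (m + 1) - F m) / (F (n + 1) - F n))| ≤ M := by
      rw [Real.log_div (hpos m).ne' (hpos n).ne']
      rcases le_total n m with hle | hle
      · exact key n m hle
      · rw [abs_sub_comm]; exact key m n hle
    exact (le_exp_mul_of_abs_log_le (hpos m) (hpos n) hb).1
  · intro n
    -- The quad `(n, n + 1/2, n + 1, ∞)` around the edge `(n, n + 1)`.
    obtain ⟨δ, p, p', q⟩ := exists_pt_mul γ (a := n) (b := -(n + 1)) (c := 1) (d := -1) (by ring)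
    have := hq (γ * δ)
    rw [quadShear, shear_eq, q n (by norm_num) (by norm_num),
      p (-1) (n + 1 / 2) (by norm_num) (by push_cast; ring), p 0 (n + 1) (by norm_num) (by push_cast; ring),
      p' 1 (by norm_num), cr_mul_homPt v (by simp) (by simp) (by simp) (by simp)
        (hF' _) (hF' _) (hF' _) hFinf, Real.log_abs] at this
    refine le_exp_mul_of_abs_log_le (by linarith [h1 n, h2 n]) (by linarith [h3 n, h4 n]) ?_
    convert this using 3
    ring_nf
  · intro n
    -- The quad `(n, n + 1/3, n + 1/2, n + 1)` around the edge `(n, n + 1/2)`.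
    obtain ⟨δ, p, -, q⟩ := exists_pt_mul γ (a := -n) (b := 1 + 2 * n) (c := -1) (d := 2) (by ring)
    have := hq (γ * δ)
    rw [quadShear, shear_eq, q n (by norm_num) (by push_cast; ring),
      p (-1) (n + 1 / 3) (by norm_num) (by push_cast; ring),
      p 0 (n + 1 / 2) (by norm_num) (by push_cast; ring),
      p 1 (n + 1) (by norm_num) (by push_cast; ring),
      cr_mul_homPt v (by simp) (by simp) (by simp) (by simp)
        (hF' _) (hF' _) (hF' _) (hF' _), Real.log_abs] at this
    refine le_exp_mul_of_abs_log_le (mul_pos (by linarith [h1 n]) (by linarith [h3 n, h4 n]))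
      (mul_pos (by linarith [h2 n]) (hpos n)) ?_
    convert this using 4 <;> ring
  · intro n
    -- The quad `(n + 1/2, n + 2/3, n + 1, n)` around the edge `(n + 1/2, n + 1)`.
    obtain ⟨δ, p, -, q⟩ := exists_pt_mul γ (a := 2 * n + 1) (b := -(n + 1)) (c := 2) (d := -1)
      (by ring)
    have := hq (γ * δ)
    rw [quadShear, shear_eq, q (n + 1 / 2) (by norm_num) (by push_cast; ring),
      p (-1) (n + 2 / 3) (by norm_num) (by push_cast; ring),
      p 0 (n + 1) (by norm_num) (by push_cast; ring),
      p 1 n (by norm_num) (by push_cast; ring),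
      cr_mul_homPt v (by simp) (by simp) (by simp) (by simp)
        (hF' _) (hF' _) (hF' _) (hF' _), Real.log_abs] at this
    refine (le_exp_mul_of_abs_log_le (mul_pos (by linarith [h3 n]) (hpos n))
      (mul_pos (by linarith [h4 n]) (by linarith [h1 n, h2 n])) ?_).1
    convert this using 3
    rw [← neg_div_neg_eq]
    congr 1 <;> ring

/-! ### Bi-Lipschitz bounds at large distances -/

namespace FareyDistortion

variable {K : ℝ} {F : ℝ → ℝ}

lemma sub_le (hF : FareyDistortion K F) {m n : ℤ} (hmn : m ≤ n) :
    F n - F m ≤ (n - m) * (K * (F 1 - F 0)) := by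
  induction n, hmn using Int.leInduction with
  | base => simp
  | succ n hn ih =>
    have := hF.gap n 0
    push_cast at this ⊢
    rw [zero_add] at this
    linarith

lemma le_sub (hF : FareyDistortion K F) {m n : ℤ} (hmn : m ≤ n) :
    (n - m) * (F 1 - F 0) ≤ K * (F n - F m) := by
  induction n, hmn using Int.leInduction with
  | base => simp
  | succ n hn ih =>
    have := hF.gap 0 n
    push_cast at this ⊢
    rw [zero_add] at this
    linarith

/-- The two halves `A`, `B` are comparable with constant `K`. In the cross ratio bounds for the
thirds, the total `A + B` is at least each half and at most `1 + K` times it, which leaves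
comparisons of `X` with `Y` and of `W` with `Z`. -/
lemma third_le (hF : FareyDistortion K F) (hK : 1 ≤ K) (n : ℤ) :
    F (n + 1) - F n ≤ (1 + K) * (1 + K + K ^ 2) * (F (n + 1 / 3) - F n) ∧
    F (n + 1) - F n ≤ (1 + K) * (1 + K + K ^ 2) * (F (n + 1 / 2) - F (n + 1 / 3)) ∧
    F (n + 1) - F n ≤ (1 + K) * (1 + K + K ^ 2) * (F (n + 1) - F (n + 2 / 3)) := by
  have hX : 0 < F (n + 1 / 3) - F n := sub_pos.mpr (hF.strictMono (by linarith))
  have hY : 0 < F (n + 1 / 2) - F (n + 1 / 3) := sub_pos.mpr (hF.strictMono (by linarith))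
  have hW : 0 < F (n + 2 / 3) - F (n + 1 / 2) := sub_pos.mpr (hF.strictMono (by linarith))
  have hZ : 0 < F (n + 1) - F (n + 2 / 3) := sub_pos.mpr (hF.strictMono (by linarith))
  obtain ⟨p1, p2⟩ := hF.half n
  obtain ⟨q1, q2⟩ := hF.third n
  have r := hF.two_thirds n
  set X := F (n + 1 / 3) - F n with eX
  set Y := F (n + 1 / 2) - F (n + 1 / 3) with eY
  set W := F (n + 2 / 3) - F (n + 1 / 2) with eW
  set Z := F (n + 1) - F (n + 2 / 3) with eZ
  have e1 : F (n + 1 / 2) - F n = X + Y := by rw [eX, eY]; ring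
  have e2 : F (n + 1) - F (n + 1 / 2) = W + Z := by rw [eW, eZ]; ring
  have e3 : F (n + 1) - F n = X + Y + (W + Z) := by rw [eX, eY, eW, eZ]; ring
  rw [e1, e2] at p1 p2
  rw [e2, e3] at q1 q2
  rw [e1, e3] at r
  rw [e3]
  set A := X + Y with eA
  set B := W + Z with eB
  have hA : 0 < A := by positivity
  have hB : 0 < B := by positivity
  have s1 : Y ≤ K * X := by
    by_contra! hc
    have : K * X * B < Y * (A + B) := by nlinarith
    linarith
  have s2 : X ≤ K * (1 + K) * Y := by
    have : X * B ≤ K * (1 + K) * Y * B := by 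
      linarith [mul_le_mul_of_nonneg_left (mul_le_mul_of_nonneg_left p1 hY.le) (zero_le_one.trans hK)]
    exact le_of_mul_le_mul_right this hB
  have s3 : W ≤ K * Z := by
    by_contra! hc
    have : K * Z * A < W * (A + B) := by nlinarith
    linarith
  have hK2 : 0 < K ^ 2 := by positivity
  refine ⟨?_, ?_, ?_⟩
  · calc A + B ≤ (1 + K) * A := by linarith
      _ ≤ (1 + K) * ((1 + K + K ^ 2) * X) := by gcongr; nlinarith
      _ = _ := by ring
  · calc A + B ≤ (1 + K) * A := by linarith
      _ ≤ (1 + K) * ((1 + K + K ^ 2) * Y) := by gcongr; nlinarith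
      _ = _ := by ring
  · calc A + B ≤ (1 + K) * B := by linarith
      _ ≤ (1 + K) * ((1 + K + K ^ 2) * Z) := by gcongr; nlinarith
      _ = _ := by ring

/-- With `n = ⌈u⌉`, an interval `[u, v]` of length at least `2/3` contains `[n, n + 1/3]`, `[n -
1/3, n]` or `[n - 2/3, n - 1/2]`, and the image of each is comparable to that of a whole unit
interval. -/
lemma exists_gap_le (hF : FareyDistortion K F) (hK : 1 ≤ K) {u v : ℝ} (huv : u + 0.7 ≤ v) :
    ∃ n : ℤ, F (n + 1) - F n ≤ (1 + K) * (1 + K + K ^ 2) * (F v - F u) := by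
  have hpos : 0 ≤ (1 + K) * (1 + K + K ^ 2) := by positivity
  have hm := hF.strictMono.monotone
  have key : ∀ a b : ℝ, u ≤ a → b ≤ v → ∀ g, g ≤ (1 + K) * (1 + K + K ^ 2) * (F b - F a) →
      g ≤ (1 + K) * (1 + K + K ^ 2) * (F v - F u) := fun a b ha hb g hg =>
    hg.trans (mul_le_mul_of_nonneg_left (by linarith [hm ha, hm hb]) hpos)
  set n := ⌈u⌉ with hn
  have h1 := Int.le_ceil u
  have h2 := Int.ceil_lt_add_one u
  rw [← hn] at h1 h2
  norm_num at huv
  have hc : (((n - 1 : ℤ)) : ℝ) = n - 1 := by push_cast; ring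
  by_cases hv : (n : ℝ) + 1 / 3 ≤ v
  · exact ⟨n, key _ _ h1 hv _ (hF.third_le hK n).1⟩
  by_cases hv' : (n : ℝ) ≤ v
  · refine ⟨n - 1, key _ _ ?_ ?_ _ (hF.third_le hK (n - 1)).2.2⟩ <;> rw [hc] <;> linarith
  · refine ⟨n - 1, key _ _ ?_ ?_ _ (hF.third_le hK (n - 1)).2.1⟩ <;> rw [hc] <;> linarith

/-- On distances that are not small, `F` is bi-Lipschitz after rescaling. -/
lemma bilipschitz (hF : FareyDistortion K F) (hK : 1 ≤ K) {u v : ℝ} (huv : u + 0.7 ≤ v) :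
    F v - F u ≤ 4 * K * (F 1 - F 0) * (v - u) ∧
    (F 1 - F 0) * (v - u) ≤ 3 * K * ((1 + K) * (1 + K + K ^ 2)) * (F v - F u) := by
  have hm := hF.strictMono.monotone
  have hg : 0 < F 1 - F 0 := sub_pos.mpr (hF.strictMono one_pos)
  have hL : 1 ≤ (1 + K) * (1 + K + K ^ 2) := by nlinarith
  have hFuv : 0 < F v - F u := sub_pos.mpr (hF.strictMono (by norm_num at huv; linarith))
  have huv' : u + 7 / 10 ≤ v := by norm_num at huv; exact huv
  constructor
  · have h1 := hF.sub_le (m := ⌊u⌋) (n := ⌈v⌉)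
      (Int.cast_le (R := ℝ).mp (by linarith [Int.floor_le u, Int.le_ceil v]))
    have h2 := hm (Int.floor_le u)
    have h3 := hm (Int.le_ceil v)
    -- Rounding outwards adds less than `2`, which is at most `3 (v - u)` because `v - u ≥ 0.7`.
    have h4 : (⌈v⌉ : ℝ) - ⌊u⌋ ≤ 4 * (v - u) := by
      linarith [Int.ceil_lt_add_one v, Int.lt_floor_add_one u]
    have h5 := mul_le_mul_of_nonneg_right h4 (show 0 ≤ K * (F 1 - F 0) by positivity)
    linarith
  -- Short intervals contain one of the pieces of `exists_gap_le`; from length `3` on, the integral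
  -- intervals inside make up at least a third of the length.
  · rcases le_total (v - u) 3 with h | h
    · obtain ⟨n, hn⟩ := hF.exists_gap_le hK huv
      have h1 := hF.gap 0 n
      push_cast at h1
      rw [zero_add] at h1
      have h2 := mul_le_mul_of_nonneg_left hn (show 0 ≤ K by linarith)
      have h3 := mul_le_mul_of_nonneg_left h hg.le
      linarith
    · have h1 := hF.le_sub (m := ⌈u⌉) (n := ⌊v⌋)
        (Int.cast_le (R := ℝ).mp (by linarith [Int.lt_floor_add_one v, Int.ceil_lt_add_one u]))
      have h2 := hm (Int.le_ceil u)
      have h3 := hm (Int.floor_le v)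
      have h4 : (v - u) ≤ 3 * ((⌊v⌋ : ℝ) - ⌈u⌉) := by
        linarith [Int.lt_floor_add_one v, Int.ceil_lt_add_one u]
      have h5 := mul_le_mul_of_nonneg_right h4 hg.le
      have h6 : K * (F v - F u) * 1 ≤ K * (F v - F u) * ((1 + K) * (1 + K + K ^ 2)) :=
        mul_le_mul_of_nonneg_left hL (by positivity)
      have h7 : K * (F ⌊v⌋ - F ⌈u⌉) ≤ K * (F v - F u) :=
        mul_le_mul_of_nonneg_left (by linarith) (by linarith)
      linarith

lemma abs_bilipschitz (hF : FareyDistortion K F) (hK : 1 ≤ K) {u v : ℝ} (huv : 0.7 ≤ |v - u|) :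
    |F v - F u| ≤ 4 * K * (F 1 - F 0) * |v - u| ∧
    (F 1 - F 0) * |v - u| ≤ 3 * K * ((1 + K) * (1 + K + K ^ 2)) * |F v - F u| := by
  rcases le_total u v with h | h
  · rw [abs_of_nonneg (sub_nonneg.mpr h)] at huv ⊢
    rw [abs_of_nonneg (sub_nonneg.mpr (hF.strictMono.monotone h))]
    exact hF.bilipschitz hK (by linarith)
  · rw [abs_sub_comm, abs_of_nonneg (sub_nonneg.mpr h)] at huv
    rw [abs_sub_comm v u, abs_sub_comm (F v), abs_of_nonneg (sub_nonneg.mpr h),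
      abs_of_nonneg (sub_nonneg.mpr (hF.strictMono.monotone h))]
    exact hF.bilipschitz hK (by linarith)

end FareyDistortion

end FareyShear

namespace FareyShear

/-! ### Symmetric quadruples in reduced position -/

lemma det_eq_one_real (γ : SL(2, ℤ)) : (γ 0 0 : ℝ) * γ 1 1 - γ 0 1 * γ 1 0 = 1 := by
  have hdet := γ.det_coe
  rw [Matrix.det_fin_two] at hdet
  exact_mod_cast hdet

/-- Reduction of a real unimodular matrix (with columns `(p, q)` and `(r, s)`) modulo `SL(2, ℤ)`. -/
lemma exists_reduced {p q r s : ℝ} (hdet : p * s - r * q = 1) :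
    ∃ (γ : SL(2, ℤ)) (a b c d : ℝ), a * d - b * c = 1 ∧ (c ^ 2 + d ^ 2) ^ 2 ≤ 4 / 3 ∧
      γ 0 0 * a + γ 0 1 * c = p ∧ γ 1 0 * a + γ 1 1 * c = q ∧
      γ 0 0 * b + γ 0 1 * d = r ∧ γ 1 0 * b + γ 1 1 * d = s := by
  have hqs : 0 < q ^ 2 + s ^ 2 := by
    by_contra! h
    have h1 : q = 0 := by nlinarith [sq_nonneg q, sq_nonneg s]
    have h2 : s = 0 := by nlinarith [sq_nonneg q, sq_nonneg s]
    rw [h1, h2] at hdet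
    simp at hdet
  set D : ℂ := q * Complex.I + s with hD
  have hnD : Complex.normSq D = q ^ 2 + s ^ 2 := by
    rw [hD, Complex.normSq_apply]
    simp
    ring
  have hD0 : D ≠ 0 := by
    rw [← Complex.normSq_pos, hnD]; exact hqs
  have him : ((p * Complex.I + r) / D).im = 1 / (q ^ 2 + s ^ 2) := by
    rw [Complex.div_im, hnD, hD]
    simp
    rw [← sub_div, hdet, one_div]
  -- `τ` is the image of `i` under the given matrix. In the fundamental domain the imaginary part is
  -- at least `√3 / 2`, and that of the moved point is `1 / (c ^ 2 + d ^ 2)`.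
  set τ : UpperHalfPlane := ⟨(p * Complex.I + r) / D, by rw [him]; positivity⟩ with hτ
  obtain ⟨g, hg⟩ := ModularGroup.exists_smul_mem_fd τ
  have h3 := ModularGroup.three_le_four_mul_im_sq_of_mem_fd hg
  have hden : Complex.normSq (UpperHalfPlane.denom g τ) * (q ^ 2 + s ^ 2) =
      (g 1 0 * p + g 1 1 * q) ^ 2 + (g 1 0 * r + g 1 1 * s) ^ 2 := by
    rw [← hnD, ← Complex.normSq_mul, ModularGroup.denom_apply]
    have : ((g 1 0 : ℂ) * (τ : ℂ) + g 1 1) * D =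
        ((g 1 0 * r + g 1 1 * s : ℝ) : ℂ) + ((g 1 0 * p + g 1 1 * q : ℝ) : ℂ) * Complex.I := by
      change ((g 1 0 : ℂ) * ((p * Complex.I + r) / D) + g 1 1) * D = _
      rw [add_mul, mul_assoc, div_mul_cancel₀ _ hD0, hD]
      push_cast
      ring
    rw [this, Complex.normSq_add_mul_I]
    ring
  have himτ : τ.im = 1 / (q ^ 2 + s ^ 2) := him
  have hgd := det_eq_one_real g
  refine ⟨g⁻¹, g 0 0 * p + g 0 1 * q, g 0 0 * r + g 0 1 * s, g 1 0 * p + g 1 1 * q,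
    g 1 0 * r + g 1 1 * s, ?_, ?_, ?_⟩
  · calc _ = ((g 0 0 : ℝ) * g 1 1 - g 0 1 * g 1 0) * (p * s - r * q) := by ring
      _ = 1 := by rw [hgd, hdet, one_mul]
  · rw [ModularGroup.im_smul_eq_div_normSq, himτ, div_div, mul_comm (q ^ 2 + s ^ 2), hden] at h3
    set N := (g 1 0 * p + g 1 1 * q) ^ 2 + (g 1 0 * r + g 1 1 * s) ^ 2
    have hN : N ≠ 0 := by
      intro hN
      rw [hN] at h3
      norm_num at h3
    have hN2 : 0 < N ^ 2 := by positivity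
    rw [div_pow, one_pow, mul_one_div, le_div_iff₀ hN2] at h3
    linarith
  · rw [Matrix.SpecialLinearGroup.SL2_inv_expl]
    simp
    refine ⟨?_, ?_, ?_, ?_⟩
    · linear_combination p * hgd
    · linear_combination q * hgd
    · linear_combination r * hgd
    · linear_combination s * hgd

lemma eq_pt_of_homPt {z : Circle} {γ : SL(2, ℤ)} {a c k : ℝ} (hk : k ≠ 0) (hc : a ≠ 0 ∨ c ≠ 0)
    {p q : ℝ} (hz : (z : ℂ) = homPt p q)
    (h₁ : γ 0 0 * a + γ 0 1 * c = k * p) (h₂ : γ 1 0 * a + γ 1 1 * c = k * q)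
    (hn : z ≠ pt γ ∞) : c ≠ 0 ∧ z = pt γ ((a / c : ℝ) : OnePoint ℝ) := by
  have hc0 : c ≠ 0 := by
    rintro rfl
    have ha := hc.resolve_right (not_not.mpr rfl)
    refine hn (Circle.ext ?_)
    rw [hz, pt_infty, ← homPt_smul hk, ← h₁, ← h₂, ← homPt_smul ha ((γ 0 0 : ℤ) : ℝ)]
    congr 1 <;> ring
  refine ⟨hc0, Circle.ext ?_⟩
  rw [hz, pt_coe, ← homPt_smul hk, ← h₁, ← h₂, ← homPt_smul hc0 (_ * (a / c) + _)]
  congr 1 <;> field_simp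

lemma le_abs_one_div {x : ℝ} (h : |x| ≤ 1.4) (h0 : x ≠ 0) : (0.7 : ℝ) ≤ |1 / x| := by
  have := abs_pos.mpr h0
  rw [abs_div, abs_one, le_div_iff₀ this]
  norm_num at *
  linarith

/-- The form `c ^ 2 + c d` has eigenvalues `(1 ± √2) / 2`, so the bound is about `1.2072 · 1.155 <
1.4`. The two squares nearly vanish along the eigenvectors. -/
lemma abs_mul_add_le {c d : ℝ} (h : c ^ 2 + d ^ 2 ≤ 231 / 200) : |c * (c + d)| ≤ 1.4 := by
  rw [abs_le]
  norm_num
  constructor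
  · nlinarith [sq_nonneg (c + 0.414 * d)]
  · nlinarith [sq_nonneg (c - 2.414 * d)]

/-- A symmetric quadruple of points of the circle that are not vertices, in suitable coordinates. -/
lemma exists_quad_coords {x t : ℝ} (ht : 0 < t) (ht' : t < Real.pi)
    (hx : ∀ γ : SL(2, ℤ), Circle.exp x ≠ pt γ ∞ ∧ Circle.exp (x + Real.pi) ≠ pt γ ∞ ∧
      Circle.exp (x + t) ≠ pt γ ∞ ∧ Circle.exp (x - t) ≠ pt γ ∞) :
    ∃ (γ : SL(2, ℤ)) (y₁ y₂ y₃ y₄ : ℝ), Circle.exp (x + Real.pi) = pt γ y₁ ∧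
      Circle.exp (x - t) = pt γ y₂ ∧ Circle.exp x = pt γ y₃ ∧ Circle.exp (x + t) = pt γ y₄ ∧
      0.7 ≤ |y₂ - y₁| ∧ 0.7 ≤ |y₄ - y₃| ∧ 0.7 ≤ |y₃ - y₂| ∧ 0.7 ≤ |y₄ - y₁| ∧
      |y₂ - y₁| * |y₄ - y₃| = |y₃ - y₂| * |y₄ - y₁| := by
  have hc := Real.cos_pos_of_mem_Ioo (x := t / 2) ⟨by linarith, by linarith⟩
  have hs := Real.sin_pos_of_pos_of_lt_pi (x := t / 2) (by linarith) (by linarith)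
  -- The scale that gives the matrix below determinant one.
  set k := (Real.sqrt (Real.cos (t / 2) * Real.sin (t / 2)))⁻¹ with hk
  have hk0 : 0 < k := by positivity
  have hk2 : k ^ 2 * (Real.cos (t / 2) * Real.sin (t / 2)) = 1 := by
    rw [hk, inv_pow, Real.sq_sqrt (by positivity), inv_mul_cancel₀ (by positivity)]
  have hcs := Real.sin_sq_add_cos_sq (x / 2)
  -- This matrix carries `∞, 0, 1, -1` to the points of angles `x`, `x + π`, `x - t`, `x + t`, so it
  -- carries `i` to the crossing point of the geodesics that join opposite points.
  obtain ⟨γ, a, b, c, d, hdet, hcd, e1, e2, e3, e4⟩ := exists_reduced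
    (p := k * Real.cos (t / 2) * Real.cos (x / 2)) (q := k * Real.cos (t / 2) * -Real.sin (x / 2))
    (r := k * Real.sin (t / 2) * Real.sin (x / 2)) (s := k * Real.sin (t / 2) * Real.cos (x / 2))
    (by linear_combination k ^ 2 * (Real.cos (t / 2) * Real.sin (t / 2)) * hcs + hk2)
  obtain ⟨hx1, hx2, hx3, hx4⟩ := hx γ
  have n1 : a ≠ 0 ∨ c ≠ 0 := by
    by_contra! h; rw [h.1, h.2] at hdet; simp at hdet
  have n2 : b ≠ 0 ∨ d ≠ 0 := by
    by_contra! h; rw [h.1, h.2] at hdet; simp at hdet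
  have n3 : a - b ≠ 0 ∨ c - d ≠ 0 := by
    by_contra! h
    rw [sub_eq_zero.mp h.1, sub_eq_zero.mp h.2] at hdet; simp at hdet
  have n4 : a + b ≠ 0 ∨ c + d ≠ 0 := by
    by_contra! h
    rw [eq_neg_of_add_eq_zero_left h.1, eq_neg_of_add_eq_zero_left h.2] at hdet; simp at hdet
  have hkc : k * Real.cos (t / 2) ≠ 0 := by positivity
  have hks : k * Real.sin (t / 2) * (-1) ≠ 0 := by
    simpa using ⟨hk0.ne', hs.ne'⟩
  obtain ⟨c1, p1⟩ := eq_pt_of_homPt hkc n1 (exp_eq_homPt x) e1 e2 hx1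
  obtain ⟨c2, p2⟩ := eq_pt_of_homPt (γ := γ) hks n2 (exp_eq_homPt (x + Real.pi))
    (by rw [e3, add_div, Real.cos_add_pi_div_two]; ring)
    (by rw [e4, add_div, Real.sin_add_pi_div_two]; ring) hx2
  obtain ⟨c3, p3⟩ := eq_pt_of_homPt (γ := γ) hk0.ne' n3 (exp_eq_homPt (x + t))
    (by rw [add_div, Real.cos_add]; linear_combination e1 - e3)
    (by rw [add_div, Real.sin_add]; linear_combination e2 - e4) hx3
  obtain ⟨c4, p4⟩ := eq_pt_of_homPt (γ := γ) hk0.ne' n4 (exp_eq_homPt (x - t))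
    (by rw [sub_div, Real.cos_sub]; linear_combination e1 + e3)
    (by rw [sub_div, Real.sin_sub]; linear_combination e2 + e4) hx4
  -- `1.155` is slightly more than `2 / √3`.
  have hcd' : c ^ 2 + d ^ 2 ≤ 1.155 := by norm_num; nlinarith [sq_nonneg c, sq_nonneg d]
  norm_num at hcd'
  have s1 : b / d + (-1 / (d * (c + d))) * (-1) = (a + b) / (c + d) := by
    field_simp
    linear_combination -hdet
  have s21 : (a + b) / (c + d) - b / d = 1 / (d * (c + d)) := by
    rw [div_sub_div _ _ c4 c2, mul_comm d]
    congr 1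
    linear_combination hdet
  have s43 : (a - b) / (c - d) - a / c = 1 / (c * (c - d)) := by
    rw [div_sub_div _ _ c3 c1, mul_comm c (c - d)]
    congr 1
    linear_combination hdet
  have s32 : a / c - (a + b) / (c + d) = 1 / (c * (c + d)) := by
    rw [div_sub_div _ _ c1 c4]
    congr 1
    linear_combination hdet
  have s41 : (a - b) / (c - d) - b / d = 1 / (d * (c - d)) := by
    rw [div_sub_div _ _ c3 c2, mul_comm d]
    congr 1
    linear_combination hdet
  refine ⟨γ, b / d, (a + b) / (c + d), a / c, (a - b) / (c - d), p2, p4, p1, p3, ?_⟩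
  rw [s21, s43, s32, s41]
  refine ⟨le_abs_one_div ?_ (mul_ne_zero c2 c4), le_abs_one_div ?_ (mul_ne_zero c1 c3),
    le_abs_one_div ?_ (mul_ne_zero c1 c4), le_abs_one_div ?_ (mul_ne_zero c2 c3), ?_⟩
  · rw [add_comm]; exact abs_mul_add_le (by linarith)
  · rw [sub_eq_add_neg]; exact abs_mul_add_le (by rw [neg_sq]; linarith)
  · exact abs_mul_add_le (by linarith)
  · rw [← abs_neg, ← mul_neg, neg_sub, sub_eq_add_neg]
    exact abs_mul_add_le (by rw [neg_sq]; linarith)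
  · rw [← abs_mul, ← abs_mul, div_mul_div_comm, div_mul_div_comm]
    ring_nf

/-! ### Quasisymmetry -/

lemma countable_vertices : (Set.range fun γ : SL(2, ℤ) => pt γ ∞).Countable := by
  have hinj : Function.Injective
      fun (γ : SL(2, ℤ)) (p : Fin 2 × Fin 2) => (γ p.1 p.2 : ℤ) := fun γ δ h =>
    Matrix.SpecialLinearGroup.ext _ _ fun i j => congrFun h (i, j)
  have := hinj.countable
  exact Set.countable_range _

lemma countable_exp_preimage {V : Set Circle} (hV : V.Countable) :
    (Circle.exp ⁻¹' V).Countable := by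
  have : Circle.exp ⁻¹' V ⊆ ⋃ v ∈ V, Set.range fun m : ℤ => (v : ℂ).arg + m * (2 * Real.pi) := by
    intro x hx
    obtain ⟨m, hm⟩ := Circle.exp_eq_exp.mp (Circle.exp_arg (Circle.exp x)).symm
    exact Set.mem_biUnion hx ⟨m, hm.symm⟩
  exact (hV.biUnion fun _ _ => Set.countable_range _).mono this

/-- Away from the vertices the four points have finite coordinates in every chart. Only countably
many `x` are excluded. -/
lemma dense_generic (t : ℝ) : Dense {x : ℝ | ∀ γ : SL(2, ℤ), Circle.exp x ≠ pt γ ∞ ∧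
    Circle.exp (x + Real.pi) ≠ pt γ ∞ ∧ Circle.exp (x + t) ≠ pt γ ∞ ∧
    Circle.exp (x - t) ≠ pt γ ∞} := by
  have hW := countable_exp_preimage countable_vertices
  set W := Circle.exp ⁻¹' Set.range fun γ : SL(2, ℤ) => pt γ ∞ with hWdef
  have hc : ∀ s : ℝ, ((fun x : ℝ => x + s) ⁻¹' W).Countable := fun s =>
    hW.preimage (add_left_injective s)
  refine (Set.Countable.dense_compl ℝ ((hc 0).union ((hc Real.pi).union ((hc t).union
    (hc (-t)))))).mono ?_
  intro x hx γ
  simp only [Set.mem_compl_iff, Set.mem_union, not_or, hWdef, Set.mem_preimage, Set.mem_range,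
    not_exists, add_zero, ← sub_eq_add_neg] at hx
  exact ⟨fun h => hx.1 γ h.symm, fun h => hx.2.1 γ h.symm, fun h => hx.2.2.1 γ h.symm,
    fun h => hx.2.2.2 γ h.symm⟩

lemma circle_dist_eq (p q : Circle) : dist p q = ‖(p : ℂ) - q‖ :=
  Complex.dist_eq p q

lemma le_mul_of_div_eq_div {a b A B T : ℝ} (hb : 0 < b) (hB : 0 < B) (h : a / b = A / B)
    (hT : A ≤ T * B) : a ≤ T * b := by
  rw [← div_le_iff₀ hB] at hT
  rwa [← div_le_iff₀ hb, h]

/-- The chords of the image points have the same cross ratio as the values of `F`. The bi-Lipschitz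
bounds transfer the equality of the two products in the source to the target, and the scale `F 1 - F
0` cancels. -/
lemma dist_mul_dist_le_of_generic {h : Circle ≃ₜ Circle} (ho : OrientationPreserving h) {M : ℝ}
    (hM : ∀ (γ : SL(2, ℤ)) (n m : ℤ), n ≤ m →
      |∑ i ∈ Finset.Icc n m, shearCoord h (fan γ i)| ≤ M) (hM0 : 0 ≤ M) :
    ∃ B : ℝ, 1 ≤ B ∧ ∀ (γ : SL(2, ℤ)) (y₁ y₂ y₃ y₄ : ℝ), 0.7 ≤ |y₂ - y₁| → 0.7 ≤ |y₄ - y₃| →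
      0.7 ≤ |y₃ - y₂| → 0.7 ≤ |y₄ - y₁| → |y₂ - y₁| * |y₄ - y₃| = |y₃ - y₂| * |y₄ - y₁| →
      dist (h (pt γ y₂)) (h (pt γ y₁)) * dist (h (pt γ y₄)) (h (pt γ y₃)) ≤
        B * (dist (h (pt γ y₃)) (h (pt γ y₂)) * dist (h (pt γ y₄)) (h (pt γ y₁))) ∧
      dist (h (pt γ y₃)) (h (pt γ y₂)) * dist (h (pt γ y₄)) (h (pt γ y₁)) ≤
        B * (dist (h (pt γ y₂)) (h (pt γ y₁)) * dist (h (pt γ y₄)) (h (pt γ y₃))) := by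
  set K := Real.exp M
  have hK : 1 ≤ K := Real.one_le_exp hM0
  set L := 3 * K * ((1 + K) * (1 + K + K ^ 2)) with hL
  have hL1 : 1 ≤ L := by
    have h1 : 1 ≤ (1 + K) * (1 + K + K ^ 2) := by nlinarith
    nlinarith
  -- Two upper bounds contribute `4 K` each and two lower bounds contribute `L` each.
  refine ⟨(4 * K) ^ 2 * L ^ 2, one_le_mul_of_one_le_of_one_le (one_le_pow₀ (by linarith))
    (one_le_pow₀ hL1), ?_⟩
  intro γ y₁ y₂ y₃ y₄ h21 h43 h32 h41 heq
  obtain ⟨F, hFm, hF⟩ := ho.exists_chart γ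
  have hD := chart_fareyDistortion hM hFm hF
  set v := h (pt γ ∞)
  have hF' : ∀ x : ℝ, (h (pt γ x) : ℂ) = v * homPt (F x) 1 := fun x => by
    rw [hF, Circle.coe_mul, cayleyInv_coe]
  have hg : 0 < F 1 - F 0 := sub_pos.mpr (hFm one_pos)
  have hcr := cr_mul_homPt v (by simp) (by simp) (by simp) (by simp)
    (hF' y₁) (hF' y₂) (hF' y₃) (hF' y₄)
  simp only [mul_one, cr, norm_div, norm_mul, abs_div, abs_mul, ← circle_dist_eq] at hcr
  obtain ⟨u21, l21⟩ := hD.abs_bilipschitz hK h21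
  obtain ⟨u43, l43⟩ := hD.abs_bilipschitz hK h43
  obtain ⟨u32, l32⟩ := hD.abs_bilipschitz hK h32
  obtain ⟨u41, l41⟩ := hD.abs_bilipschitz hK h41
  have hne : ∀ a b : ℝ, 0.7 ≤ |b - a| → 0 < |F b - F a| ∧ 0 < dist (h (pt γ b)) (h (pt γ a)) := by
    intro a b hab
    have hab' : b ≠ a := by
      rintro rfl
      norm_num at hab
    refine ⟨abs_pos.mpr (sub_ne_zero.mpr (hFm.injective.ne hab')), dist_pos.mpr fun he => hab' ?_⟩
    simpa using pt_injective γ (h.injective he)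
  obtain ⟨f21, d21⟩ := hne _ _ h21
  obtain ⟨f43, d43⟩ := hne _ _ h43
  obtain ⟨f32, d32⟩ := hne _ _ h32
  obtain ⟨f41, d41⟩ := hne _ _ h41
  have key : ∀ a b c d a' b' c' d' : ℝ, 0 ≤ a → 0 ≤ b → 0 ≤ c → 0 ≤ d → 0 ≤ c' → 0 ≤ d' →
      0 ≤ a' → 0 ≤ b' →
      a ≤ 4 * K * (F 1 - F 0) * a' → b ≤ 4 * K * (F 1 - F 0) * b' →
      (F 1 - F 0) * c' ≤ L * c → (F 1 - F 0) * d' ≤ L * d → a' * b' = c' * d' →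
      a * b ≤ (4 * K) ^ 2 * L ^ 2 * (c * d) := by
    intro a b c d a' b' c' d' ha hb hc hd hc' hd' ha' hb' h1 h2 h3 h4 h5
    calc a * b ≤ (4 * K * (F 1 - F 0) * a') * (4 * K * (F 1 - F 0) * b') := by gcongr
      _ = (4 * K) ^ 2 * (F 1 - F 0) ^ 2 * (a' * b') := by ring
      _ = (4 * K) ^ 2 * (((F 1 - F 0) * c') * ((F 1 - F 0) * d')) := by rw [h5]; ring
      _ ≤ (4 * K) ^ 2 * ((L * c) * (L * d)) := by gcongr
      _ = _ := by ring
  have k1 := key _ _ _ _ _ _ _ _ f21.le f43.le f32.le f41.le (abs_nonneg _) (abs_nonneg _)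
    (abs_nonneg _) (abs_nonneg _) u21 u43 l32 l41 heq
  have k2 := key _ _ _ _ _ _ _ _ f32.le f41.le f21.le f43.le (abs_nonneg _) (abs_nonneg _)
    (abs_nonneg _) (abs_nonneg _) u32 u41 l21 l43 heq.symm
  exact ⟨le_mul_of_div_eq_div (by positivity) (by positivity) hcr k1,
    le_mul_of_div_eq_div (by positivity) (by positivity)
      (by simpa only [inv_div] using congrArg Inv.inv hcr) k2⟩

lemma exists_dist_mul_dist_le {h : Circle ≃ₜ Circle} (ho : OrientationPreserving h) {M : ℝ}
    (hM : ∀ (γ : SL(2, ℤ)) (n m : ℤ), n ≤ m →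
      |∑ i ∈ Finset.Icc n m, shearCoord h (fan γ i)| ≤ M) (hM0 : 0 ≤ M) :
    ∃ B : ℝ, 1 ≤ B ∧ ∀ x t : ℝ, 0 < t → t < Real.pi →
      dist (h (Circle.exp (x - t))) (h (Circle.exp (x + Real.pi))) *
          dist (h (Circle.exp (x + t))) (h (Circle.exp x)) ≤
        B * (dist (h (Circle.exp x)) (h (Circle.exp (x - t))) *
          dist (h (Circle.exp (x + t))) (h (Circle.exp (x + Real.pi)))) ∧
      dist (h (Circle.exp x)) (h (Circle.exp (x - t))) *
          dist (h (Circle.exp (x + t))) (h (Circle.exp (x + Real.pi))) ≤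
        B * (dist (h (Circle.exp (x - t))) (h (Circle.exp (x + Real.pi))) *
          dist (h (Circle.exp (x + t))) (h (Circle.exp x))) := by
  obtain ⟨B, hB, hgen⟩ := dist_mul_dist_le_of_generic ho hM hM0
  refine ⟨B, hB, fun x t ht ht' => ?_⟩
  have hc : ∀ s : ℝ, Continuous fun x : ℝ => h (Circle.exp (x + s)) := fun s =>
    h.continuous.comp (Circle.exp.continuous.comp (continuous_add_const s))
  have c0 : Continuous fun x : ℝ => h (Circle.exp x) := h.continuous.comp Circle.exp.continuous
  have c1 := hc Real.pi
  have c2 := hc t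
  have c3 : Continuous fun x : ℝ => h (Circle.exp (x - t)) := by
    simpa only [sub_eq_add_neg] using hc (-t)
  have hclosed := (isClosed_le ((c3.dist c1).mul (c2.dist c0))
    (((c0.dist c3).mul (c2.dist c1)).const_mul B)).inter
    (isClosed_le ((c0.dist c3).mul (c2.dist c1)) (((c3.dist c1).mul (c2.dist c0)).const_mul B))
  -- Both inequalities are closed conditions on `x`, so it suffices to check them at generic `x`.
  have hsub := (dense_generic t).closure_eq.symm.trans_le (hclosed.closure_subset_iff.mpr ?_)
  · exact hsub (Set.mem_univ x)
  · intro x hx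
    obtain ⟨γ, y₁, y₂, y₃, y₄, e1, e2, e3, e4, h21, h43, h32, h41, heq⟩ :=
      exists_quad_coords ht ht' hx
    have := hgen γ y₁ y₂ y₃ y₄ h21 h43 h32 h41 heq
    rw [← e1, ← e2, ← e3, ← e4] at this
    exact this

lemma one_le_dist_exp {a b : ℝ} (h : Real.cos (a - b) ≤ 0) :
    1 ≤ dist (Circle.exp a) (Circle.exp b) := by
  rw [circle_dist_eq, ← one_le_sq_iff₀ (norm_nonneg _), Complex.sq_norm, Complex.normSq_apply, Circle.coe_exp,
    Circle.coe_exp, Complex.sub_re, Complex.sub_im, Complex.exp_ofReal_mul_I_re,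
    Complex.exp_ofReal_mul_I_re, Complex.exp_ofReal_mul_I_im, Complex.exp_ofReal_mul_I_im]
  rw [Real.cos_sub] at h
  nlinarith [Real.sin_sq_add_cos_sq a, Real.sin_sq_add_cos_sq b]

/-- Compactness of the set of pairs at distance at least `1`. This bounds from below the chords that
end at the image of the antipode of `exp x`. -/
lemma exists_le_dist_map (h : Circle ≃ₜ Circle) :
    ∃ δ : ℝ, 0 < δ ∧ ∀ p q : Circle, 1 ≤ dist p q → δ ≤ dist (h p) (h q) := by
  have hcomp : IsCompact {pq : Circle × Circle | 1 ≤ dist pq.1 pq.2} :=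
    (isClosed_le continuous_const continuous_dist).isCompact
  have hne : {pq : Circle × Circle | 1 ≤ dist pq.1 pq.2}.Nonempty :=
    ⟨(Circle.exp Real.pi, Circle.exp 0), one_le_dist_exp (by simp)⟩
  obtain ⟨pq, hpq, hmin⟩ := hcomp.exists_isMinOn hne
    (f := fun pq : Circle × Circle => dist (h pq.1) (h pq.2)) (by fun_prop)
  refine ⟨_, dist_pos.mpr fun he => ?_, fun p q h' => hmin (a := (p, q)) h'⟩
  have := h.injective he
  simp only [Set.mem_ofPred_eq, this, dist_self] at hpq
  linarith

lemma dist_circle_le_two (p q : Circle) : dist p q ≤ 2 := by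
  rw [circle_dist_eq]
  refine (norm_sub_le _ _).trans ?_
  rw [Circle.norm_coe, Circle.norm_coe]
  norm_num

/-- An orientation-preserving homeomorphism whose shears have bounded sums along fans is
quasisymmetric. -/
theorem quasisymmetric_of_fanSumsBounded {h : Circle ≃ₜ Circle} (ho : OrientationPreserving h)
    (hs : FanSumsBounded (shearCoord h)) : Quasisymmetric h := by
  obtain ⟨M, hM0, hM⟩ := hs
  obtain ⟨B, hB, hBd⟩ := exists_dist_mul_dist_le ho hM hM0
  obtain ⟨δ, hδ, hmin⟩ := exists_le_dist_map h
  have hδ2 : δ ≤ 2 :=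
    (hmin (Circle.exp Real.pi) (Circle.exp 0) (one_le_dist_exp (by simp))).trans
      (dist_circle_le_two _ _)
  have hK : 1 ≤ B * (2 / δ) :=
    one_le_mul_of_one_le_of_one_le hB (by rwa [one_le_div hδ])
  refine ⟨ho, B * (2 / δ), hK, fun x t ht ht' => ?_⟩
  have hpi := Real.pi_pos
  obtain ⟨b1, b2⟩ := hBd x t ht (by linarith)
  have hcos := Real.cos_nonneg_of_mem_Icc (x := t) ⟨by linarith, ht'⟩
  -- For `t ≤ π / 2` both `x - t` and `x + t` are at least a quarter turn from `x + π`, so the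
  -- chords `r` and `s` below lie in `[δ, 2]` and can be dropped from the cross ratio.
  have l2 := hmin (Circle.exp (x - t)) (Circle.exp (x + Real.pi)) (one_le_dist_exp (by
    rw [show x - t - (x + Real.pi) = -(t + Real.pi) by ring, Real.cos_neg, Real.cos_add_pi]
    linarith))
  have l4 := hmin (Circle.exp (x + t)) (Circle.exp (x + Real.pi)) (one_le_dist_exp (by
    rw [show x + t - (x + Real.pi) = t - Real.pi by ring, Real.cos_sub_pi]
    linarith))
  have u2 := dist_circle_le_two (h (Circle.exp (x - t))) (h (Circle.exp (x + Real.pi)))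
  have u4 := dist_circle_le_two (h (Circle.exp (x + t))) (h (Circle.exp (x + Real.pi)))
  have hd : 0 < dist (h (Circle.exp x)) (h (Circle.exp (x - t))) := by
    refine dist_pos.mpr fun he => ?_
    have := Circle.exp_injOn_Icc (a := x - t) (b := x) (by linarith)
      ⟨by linarith, le_rfl⟩ ⟨le_rfl, by linarith⟩ (h.injective he)
    linarith
  set p := dist (h (Circle.exp (x + t))) (h (Circle.exp x))
  set q := dist (h (Circle.exp x)) (h (Circle.exp (x - t)))
  set r := dist (h (Circle.exp (x - t))) (h (Circle.exp (x + Real.pi)))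
  set s := dist (h (Circle.exp (x + t))) (h (Circle.exp (x + Real.pi)))
  have hp : 0 ≤ p := dist_nonneg
  constructor
  · rw [le_div_iff₀ hd, inv_mul_le_iff₀ (by positivity)]
    rw [show B * (2 / δ) * p = B * (2 * p) / δ by ring, le_div_iff₀ hδ]
    calc q * δ ≤ q * s := by gcongr
      _ ≤ B * (r * p) := b2
      _ ≤ B * (2 * p) := by gcongr
  · rw [div_le_iff₀ hd, show B * (2 / δ) * q = B * (2 * q) / δ by ring, le_div_iff₀ hδ]
    calc p * δ = δ * p := mul_comm _ _
      _ ≤ r * p := by gcongr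
      _ ≤ B * (q * s) := b1
      _ ≤ B * (q * 2) := by gcongr
      _ = _ := by ring

end FareyShear

namespace FareyShear

/-! ### Uniqueness -/

/-- Right multiplication moves a frame to a neighbour: `S` reverses the edge, and `T` passes to the
next edge of the fan. -/
lemma sl2z_induction {P : SL(2, ℤ) → Prop} (one : P 1)
    (mul_S : ∀ γ, P γ → P (γ * ModularGroup.S)) (mul_S_inv : ∀ γ, P γ → P (γ * ModularGroup.S⁻¹))
    (mul_T : ∀ γ, P γ → P (γ * ModularGroup.T)) (mul_T_inv : ∀ γ, P γ → P (γ * ModularGroup.T⁻¹))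
    (γ : SL(2, ℤ)) : P γ := by
  have hγ : γ ∈ Subgroup.closure {ModularGroup.S, ModularGroup.T} := by
    rw [SpecialLinearGroup.SL2Z_generators]; trivial
  induction hγ using Subgroup.closure_induction_right with
  | one => exact one
  | mul_right x y _ hy ih =>
    rcases hy with rfl | rfl
    · exact mul_S _ ih
    · exact mul_T _ ih
  | mul_inv_cancel x y _ hy ih =>
    rcases hy with rfl | rfl
    · exact mul_S_inv _ ih
    · exact mul_T_inv _ ih

lemma pt_mul_S_infty (γ : SL(2, ℤ)) :
    pt (γ * ModularGroup.S) ∞ = pt γ ((0 : ℝ) : OnePoint ℝ) := by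
  rw [pt_mul, S_infty, pt]

lemma pt_mul_S_zero (γ : SL(2, ℤ)) :
    pt (γ * ModularGroup.S) ((0 : ℝ) : OnePoint ℝ) = pt γ ∞ := by
  rw [pt_mul, S_zero, pt]

lemma pt_mul_S_coe (γ : SL(2, ℤ)) {x : ℝ} (hx : x ≠ 0) :
    pt (γ * ModularGroup.S) x = pt γ ((-x⁻¹ : ℝ) : OnePoint ℝ) := by
  rw [pt_mul, S_coe hx, pt]

lemma pt_mul_T_infty (γ : SL(2, ℤ)) : pt (γ * ModularGroup.T) ∞ = pt γ ∞ := by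
  simpa using pt_mul_T_zpow_infty γ 1

lemma pt_mul_T_coe (γ : SL(2, ℤ)) (x : ℝ) :
    pt (γ * ModularGroup.T) x = pt γ ((x + 1 : ℝ) : OnePoint ℝ) := by
  simpa using pt_mul_T_zpow_coe γ 1 x

lemma pt_mul_S_inv (γ : SL(2, ℤ)) : pt (γ * ModularGroup.S⁻¹) = pt (γ * ModularGroup.S) := by
  have := pt_S_S (γ * ModularGroup.S⁻¹)
  rwa [inv_mul_cancel_right, eq_comm] at this

lemma pt_mul_T_inv_infty (γ : SL(2, ℤ)) : pt (γ * ModularGroup.T⁻¹) ∞ = pt γ ∞ := by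
  simpa using pt_mul_T_zpow_infty γ (-1)

lemma pt_mul_T_inv_coe (γ : SL(2, ℤ)) (x : ℝ) :
    pt (γ * ModularGroup.T⁻¹) x = pt γ ((x - 1 : ℝ) : OnePoint ℝ) := by
  simpa [sub_eq_add_neg] using pt_mul_T_zpow_coe γ (-1) x

/-- Three corners of a Farey quad and the shear determine the fourth corner. -/
lemma corner_eq_iff_of_quadShear_eq {h h' : Circle ≃ₜ Circle} (ho : OrientationPreserving h)
    (ho' : OrientationPreserving h') {γ : SL(2, ℤ)} (hq : quadShear h γ = quadShear h' γ)
    (hinf : h (pt γ ∞) = h' (pt γ ∞)) (h0 : h (pt γ (0 : ℝ)) = h' (pt γ (0 : ℝ))) :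
    h (pt γ (1 : ℝ)) = h' (pt γ (1 : ℝ)) ↔ h (pt γ (-1 : ℝ)) = h' (pt γ (-1 : ℝ)) := by
  obtain ⟨F, hm, hF⟩ := ho.exists_chart γ
  obtain ⟨F', hm', hF'⟩ := ho'.exists_chart γ
  -- As the images of `γ(∞)` agree, both charts use the same coordinate on the target.
  have e : ∀ x : ℝ, h (pt γ x) = h' (pt γ x) ↔ F x = F' x := by
    intro x
    rw [hF, hF', hinf, mul_right_inj, cayleyInv_injective.eq_iff, OnePoint.coe_eq_coe]
  have q := quadShear_mul_T_zpow rfl hF 0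
  have q' := quadShear_mul_T_zpow rfl hF' 0
  rw [zpow_zero, mul_one] at q q'
  rw [q, q'] at hq
  rw [e] at h0 ⊢
  rw [e]
  have p1 : 0 < F 1 - F 0 := sub_pos.mpr (hm one_pos)
  have p2 : 0 < F 0 - F (-1) := sub_pos.mpr (hm (by norm_num))
  have p1' : 0 < F' 1 - F' 0 := sub_pos.mpr (hm' one_pos)
  have p2' : 0 < F' 0 - F' (-1) := sub_pos.mpr (hm' (by norm_num))
  norm_num at hq
  have hq' := Real.log_injOn_pos (div_pos p1 p2) (div_pos p1' p2') hq
  rw [div_eq_div_iff p2.ne' p2'.ne', h0] at hq'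
  rw [h0] at p1 p2
  constructor
  · intro h
    rw [h] at hq'
    have := mul_left_cancel₀ p1'.ne' hq'
    linarith
  · intro h
    rw [h] at hq'
    have := mul_right_cancel₀ p2'.ne' hq'
    linarith

/-! ### Agreement at the vertices implies equality -/

lemma exists_pt_infty_eq (q : ℚ) : ∃ γ : SL(2, ℤ), pt γ ∞ = cayleyInv ((q : ℝ) : OnePoint ℝ) := by
  have hc : IsCoprime q.num (q.den : ℤ) := by
    exact Int.isCoprime_iff_gcd_eq_one.mpr q.reduced
  obtain ⟨γ, h0, h1⟩ := hc.exists_SL2_col 0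
  refine ⟨γ, Circle.ext ?_⟩
  have hd : (q.den : ℝ) ≠ 0 := by exact_mod_cast q.den_nz
  rw [pt_infty, h0, h1, Rat.cast_def, Int.cast_natCast, cayleyInv_div _ hd]

lemma continuous_cayleyInv : Continuous cayleyInv := by
  have hc : Continuous fun x : ℝ => homPt x 1 := by
    unfold homPt
    exact Continuous.div (by fun_prop) (by fun_prop) fun x => homPt_den_ne_zero (by simp)
  rw [OnePoint.continuous_iff]
  constructor
  · rw [Filter.coclosedCompact_eq_cocompact, tendsto_iff_dist_tendsto_zero]
    refine squeeze_zero' (g := fun x : ℝ => 2 * ‖x‖⁻¹) (.of_forall fun _ => dist_nonneg) ?_ ?_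
    · filter_upwards [(isCompact_singleton (x := (0 : ℝ))).compl_mem_cocompact] with x hx
      have hx : x ≠ 0 := hx
      rw [circle_dist_eq, cayleyInv_coe, cayleyInv_infty, homPt_sub (by simp) (by simp)]
      simp only [norm_div, norm_mul, Complex.norm_real]
      norm_num
      rw [div_eq_mul_inv]
      gcongr
      simpa using Complex.abs_re_le_norm ((x : ℂ) + Complex.I)
    · simpa using (tendsto_norm_cocompact_atTop (E := ℝ)).inv_tendsto_atTop.const_mul 2
  · refine continuous_induced_rng.mpr ?_
    exact hc.congr fun x => (cayleyInv_coe x).symm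

/-- A normalized homeomorphism is determined by its shear coordinate. -/
theorem eq_of_shearCoord_eq {h h' : Circle ≃ₜ Circle} (hn : h ∈ normalizedHomeo)
    (hn' : h' ∈ normalizedHomeo) (hs : shearCoord h = shearCoord h') : h = h' := by
  obtain ⟨ho, hfix⟩ := hn
  obtain ⟨ho', hfix'⟩ := hn'
  have hq : ∀ γ, quadShear h γ = quadShear h' γ := fun γ => by
    rw [← shearCoord_fan_zero, hs, shearCoord_fan_zero]
  have key : ∀ γ : SL(2, ℤ), h (pt γ ∞) = h' (pt γ ∞) ∧ h (pt γ (0 : ℝ)) = h' (pt γ (0 : ℝ)) ∧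
      h (pt γ (1 : ℝ)) = h' (pt γ (1 : ℝ)) ∧ h (pt γ (-1 : ℝ)) = h' (pt γ (-1 : ℝ)) := by
    have mul_S : ∀ γ : SL(2, ℤ), (h (pt γ ∞) = h' (pt γ ∞) ∧
        h (pt γ (0 : ℝ)) = h' (pt γ (0 : ℝ)) ∧ h (pt γ (1 : ℝ)) = h' (pt γ (1 : ℝ)) ∧
        h (pt γ (-1 : ℝ)) = h' (pt γ (-1 : ℝ))) →
        (h (pt (γ * ModularGroup.S) ∞) = h' (pt (γ * ModularGroup.S) ∞) ∧
        h (pt (γ * ModularGroup.S) (0 : ℝ)) = h' (pt (γ * ModularGroup.S) (0 : ℝ)) ∧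
        h (pt (γ * ModularGroup.S) (1 : ℝ)) = h' (pt (γ * ModularGroup.S) (1 : ℝ)) ∧
        h (pt (γ * ModularGroup.S) (-1 : ℝ)) = h' (pt (γ * ModularGroup.S) (-1 : ℝ))) := by
      rintro γ ⟨a, b, c, d⟩
      rw [pt_mul_S_infty, pt_mul_S_zero, pt_mul_S_coe γ one_ne_zero, pt_mul_S_coe γ (by norm_num)]
      norm_num
      exact ⟨b, a, d, c⟩
    refine sl2z_induction ?_ mul_S ?_ ?_ ?_
    · have f : ∀ w : OnePoint ℝ, pt 1 w = cayleyInv w := fun w => by rw [pt, map_one, one_smul]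
      have fixed : ∀ z : Circle, (z : ℂ) ∈ ({1, Complex.I, -1} : Set ℂ) → h z = h' z :=
        fun z hz => (hfix z hz).trans (hfix' z hz).symm
      have ginf : h (pt 1 ∞) = h' (pt 1 ∞) := by
        refine fixed _ (Or.inl ?_)
        rw [f, cayleyInv_infty]; simp [homPt]
      have g0 : h (pt 1 (0 : ℝ)) = h' (pt 1 (0 : ℝ)) := by
        refine fixed _ (Or.inr (Or.inr ?_))
        rw [f, cayleyInv_coe]; simp [homPt]
      have gn : h (pt 1 (-1 : ℝ)) = h' (pt 1 (-1 : ℝ)) := by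
        refine fixed _ (Or.inr (Or.inl ?_))
        rw [f, cayleyInv_coe, homPt, div_eq_iff (homPt_den_ne_zero (by simp))]
        push_cast
        linear_combination -Complex.I_sq
      -- The normalization fixes the corners `∞`, `0`, `-1`; the shear gives the corner `1`.
      exact ⟨ginf, g0, (corner_eq_iff_of_quadShear_eq ho ho' (hq 1) ginf g0).mpr gn, gn⟩
    · intro γ hγ
      rw [pt_mul_S_inv]
      exact mul_S γ hγ
    -- The corners `∞, 0, 1` of the old quad are the corners `∞, -1, 0` of the new one, whose only
    -- new corner comes from the shear.
    · rintro γ ⟨a, b, c, d⟩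
      have a1 := a
      have b1 := b
      have c1 := c
      rw [← pt_mul_T_infty] at a1
      rw [show (0 : ℝ) = -1 + 1 by norm_num, ← pt_mul_T_coe] at b1
      rw [show (1 : ℝ) = 0 + 1 by norm_num, ← pt_mul_T_coe] at c1
      exact ⟨a1, c1, (corner_eq_iff_of_quadShear_eq ho ho' (hq _) a1 c1).mpr b1, b1⟩
    · rintro γ ⟨a, b, c, d⟩
      have a1 := a
      have b1 := b
      have d1 := d
      rw [← pt_mul_T_inv_infty] at a1
      rw [show (0 : ℝ) = 1 - 1 by norm_num, ← pt_mul_T_inv_coe] at b1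
      rw [show (-1 : ℝ) = 0 - 1 by norm_num, ← pt_mul_T_inv_coe] at d1
      exact ⟨a1, d1, b1, (corner_eq_iff_of_quadShear_eq ho ho' (hq _) a1 d1).mp b1⟩
  have hd : DenseRange fun q : ℚ => cayleyInv ((q : ℝ) : OnePoint ℝ) :=
    (cayleyInv_surjective.denseRange.comp OnePoint.denseRange_coe continuous_cayleyInv).comp
      Rat.denseRange_cast (continuous_cayleyInv.comp OnePoint.continuous_coe)
  refine Homeomorph.ext fun z => congrFun (hd.equalizer h.continuous h'.continuous ?_) z
  funext q
  obtain ⟨γ, hγ⟩ := exists_pt_infty_eq q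
  simp only [Function.comp_apply, ← hγ]
  exact (key γ).1

/-! ### Square summable diamond shears have bounded sums along fans -/

lemma pMinus_tendsto {s : Edge → ℝ} (hs : s ∈ classP) (γ : SL(2, ℤ)) :
    Tendsto (fun n : ℕ => ∑ k ∈ Finset.Icc (-(n : ℤ)) (-1), s (fan γ k)) atTop (𝓝 (pMinus s γ)) := by
  obtain ⟨l, hl⟩ := (hs γ).1
  rw [pMinus, hl.limUnder_eq]
  exact hl

/-- The sum in `classP` starts at index `0` and that in `pPlus` at index `1`, hence the subtraction
of one term. -/
lemma pPlus_tendsto {s : Edge → ℝ} (hs : s ∈ classP) (γ : SL(2, ℤ)) :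
    Tendsto (fun n : ℕ => ∑ k ∈ Finset.Icc (1 : ℤ) n, s (fan γ k)) atTop (𝓝 (pPlus s γ)) := by
  obtain ⟨l, hl⟩ := (hs γ).2
  have : Tendsto (fun n : ℕ => ∑ k ∈ Finset.Icc (1 : ℤ) n, s (fan γ k)) atTop
      (𝓝 (l - s (fan γ 0))) := by
    refine (hl.sub_const _).congr fun n => ?_
    rw [← Finset.insert_Icc_add_one_left_eq_Icc (by positivity : (0 : ℤ) ≤ n),
      Finset.sum_insert (by simp), zero_add]
    ring
  rw [pPlus, this.limUnder_eq]
  exact this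

lemma fan_mul_T (γ : SL(2, ℤ)) (k : ℤ) : fan (γ * ModularGroup.T) k = fan γ (k + 1) := by
  rw [fan_eq_fan_zero, mul_assoc, fan_eq_fan_zero γ, add_comm, zpow_add, zpow_one]

lemma sum_fan_mul_T (s : Edge → ℝ) (γ : SL(2, ℤ)) (a b : ℤ) :
    ∑ k ∈ Finset.Icc a b, s (fan (γ * ModularGroup.T) k) =
      ∑ k ∈ Finset.Icc (a + 1) (b + 1), s (fan γ k) := by
  rw [← Finset.map_add_right_Icc, Finset.sum_map]
  simp only [fan_mul_T, addRightEmbedding_apply]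

/-- In the frame `γ T` the edge `fan γ 0` has index `-1`, so it joins the sum over smaller indices.
-/
lemma pMinus_mul_T {s : Edge → ℝ} (hs : s ∈ classP) (γ : SL(2, ℤ)) :
    pMinus s (γ * ModularGroup.T) = pMinus s γ + s (fan γ 0) := by
  have h1 := (tendsto_add_atTop_iff_nat 1).mpr (pMinus_tendsto hs (γ * ModularGroup.T))
  refine tendsto_nhds_unique h1 (((pMinus_tendsto hs γ).add_const _).congr fun n => ?_)
  have : Finset.Icc (-((n + 1 : ℕ) : ℤ) + 1) (-1 + 1) = insert 0 (Finset.Icc (-(n : ℤ)) (-1)) := by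
    ext k
    simp only [Finset.mem_Icc, Finset.mem_insert]
    omega
  rw [sum_fan_mul_T, this, Finset.sum_insert (by simp), add_comm]

lemma pPlus_mul_T {s : Edge → ℝ} (hs : s ∈ classP) (γ : SL(2, ℤ)) :
    pPlus s (γ * ModularGroup.T) = pPlus s γ - s (fan γ 1) := by
  have h1 := (tendsto_add_atTop_iff_nat 1).mpr (pPlus_tendsto hs γ)
  refine tendsto_nhds_unique (pPlus_tendsto hs (γ * ModularGroup.T))
    ((h1.sub_const _).congr fun n => ?_)
  have : Finset.Icc (1 : ℤ) ((n + 1 : ℕ) : ℤ) = insert 1 (Finset.Icc (1 + 1 : ℤ) (n + 1)) := by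
    ext k
    simp only [Finset.mem_Icc, Finset.mem_insert]
    omega
  rw [sum_fan_mul_T, this, Finset.sum_insert (by simp), add_sub_cancel_left]

lemma edgeDiamond_congr (s : Edge → ℝ) {γ δ : SL(2, ℤ)} (h : pt γ = pt δ) :
    pMinus s γ = pMinus s δ ∧ pPlus s γ = pPlus s δ := by
  simp only [pMinus, pPlus, fan_congr h, and_self]

lemma fan_mul_S_zero (γ : SL(2, ℤ)) : fan (γ * ModularGroup.S) 0 = fan γ 0 := by
  refine Subtype.ext ?_
  simp only [fan, Int.cast_zero, pt_mul_S_infty, pt_mul_S_zero]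
  exact Sym2.eq_swap

/-- Sums along fans of a shear function are bounded if its diamond shear coordinate is. -/
lemma fanSumsBounded_of_edgeDiamond_le {s : Edge → ℝ} (hs : s ∈ classP) {C : ℝ}
    (hC : ∀ γ, |edgeDiamond s γ| ≤ C) : FanSumsBounded s := by
  set S := ModularGroup.S with hS
  set T := ModularGroup.T with hT
  set q : SL(2, ℤ) → ℝ := fun γ => pMinus s γ - pPlus s γ with hq
  have qcongr : ∀ {γ δ : SL(2, ℤ)}, pt γ = pt δ → q γ = q δ := fun h => by
    simp only [hq, (edgeDiamond_congr s h).1, (edgeDiamond_congr s h).2]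
  have qT : ∀ γ, q (γ * T) = q γ + s (fan γ 0) + s (fan γ 1) := fun γ => by
    simp only [hq, hT, pMinus_mul_T hs, pPlus_mul_T hs]
    ring
  have hd : ∀ γ, edgeDiamond s γ = (q γ + q (γ * S)) / 4 := fun γ => by
    simp only [edgeDiamond, hq, hS]
    ring
  have fT : ∀ γ, fan γ 1 = fan (γ * T) 0 := fun γ => by rw [hT, fan_mul_T, zero_add]
  have fS : ∀ γ, fan (γ * S) 0 = fan γ 0 := fan_mul_S_zero
  -- Up to the central element `S * S = -1`, both sides are the same frame of the edge `(0, 1)`,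
  -- pointing from `1` to `0`.
  have hrel : (S * T⁻¹ * S : SL(2, ℤ)) * S * S = T * S * T := by
    apply Subtype.ext
    simp only [hS, hT, Matrix.SpecialLinearGroup.coe_mul, ModularGroup.coe_S, ModularGroup.coe_T,
      ModularGroup.coe_T_inv]
    simp
  -- The edges `γ`, `γ T`, `γ S T⁻¹` are the sides `(∞, 0)`, `(∞, 1)`, `(0, 1)` of a Farey triangle.
  -- The rule `qT` at its three vertices relates the six values of `q` on the sides, and the signs
  -- below eliminate all of them except the one at the vertex `1` of the side `(1, ∞)`.
  have hbound : ∀ γ, |q (γ * T * S) + s (fan (γ * T) 0)| ≤ 6 * C := by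
    intro γ
    have e1 := qT γ
    have e2 := qT (γ * S * T⁻¹)
    have e3 := qT (γ * T * S)
    rw [fT, inv_mul_cancel_right, fS] at e2
    have hε : fan (γ * S * T⁻¹) 0 = fan (γ * T * S * T) 0 := by
      rw [← fS, ← congrFun (fan_congr (pt_S_S _)), mul_assoc γ, mul_assoc γ, mul_assoc γ, mul_assoc γ,
        hrel]
      simp only [mul_assoc]
    have qε : q (γ * S * T⁻¹ * S) = q (γ * T * S * T) := by
      rw [← qcongr (pt_S_S _), mul_assoc γ, mul_assoc γ, mul_assoc γ, mul_assoc γ, hrel]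
      simp only [mul_assoc]
    rw [fT, ← hε, fS] at e3
    rw [fT] at e1
    have d1 := hd γ
    have d2 := hd (γ * T)
    have d3 := hd (γ * S * T⁻¹)
    rw [qε] at d3
    have : q (γ * T * S) + s (fan (γ * T) 0) = 2 * (edgeDiamond s (γ * T) - edgeDiamond s γ +
        edgeDiamond s (γ * S * T⁻¹)) := by linarith
    rw [this]
    have b1 := abs_le.mp (hC γ)
    have b2 := abs_le.mp (hC (γ * T))
    have b3 := abs_le.mp (hC (γ * S * T⁻¹))
    rw [abs_le]
    constructor <;> linarith [b1.1, b1.2, b2.1, b2.2, b3.1, b3.2]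
  have hbound' : ∀ γ, |q γ + s (fan γ 0)| ≤ 6 * C := by
    intro γ
    have := hbound (γ * S⁻¹ * T⁻¹)
    rwa [inv_mul_cancel_right, inv_mul_cancel_right, ← fS, inv_mul_cancel_right] at this
  have hC0 : 0 ≤ C := (abs_nonneg _).trans (hC 1)
  refine ⟨6 * C, by positivity, fun γ n m hnm => ?_⟩
  -- By `qT`, the quantity `q + s` increases by `2 s(e)` from the preceding edge to `e`, so the sum
  -- telescopes.
  have hsum : ∀ m : ℤ, n ≤ m → 2 * ∑ i ∈ Finset.Icc n m, s (fan γ i) =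
      (q (γ * T ^ m) + s (fan γ m)) - (q (γ * T ^ (n - 1)) + s (fan γ (n - 1))) := by
    have hstep : ∀ k : ℤ, q (γ * T ^ k) = q (γ * T ^ (k - 1)) + s (fan γ (k - 1)) + s (fan γ k) := by
      intro k
      have := qT (γ * T ^ (k - 1))
      rwa [fT, mul_assoc, ← zpow_add_one, sub_add_cancel, hT, ← fan_eq_fan_zero,
        ← fan_eq_fan_zero] at this
    intro m hm
    induction m, hm using Int.leInduction with
    | base =>
      rw [Finset.Icc_self, Finset.sum_singleton, hstep n]
      ring
    | succ k hk ih =>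
      rw [← Finset.insert_Icc_right_eq_Icc_add_one (by omega), Finset.sum_insert (by simp), mul_add,
        ih, hstep (k + 1), add_sub_cancel_right]
      ring
  have b1 := abs_le.mp (hbound' (γ * T ^ m))
  have b2 := abs_le.mp (hbound' (γ * T ^ (n - 1)))
  rw [hT, ← fan_eq_fan_zero] at b1 b2
  have := hsum m hnm
  rw [abs_le]
  constructor <;> linarith [b1.1, b1.2, b2.1, b2.2]

theorem fanSumsBounded_of_mem_classH {s : Edge → ℝ} (hs : s ∈ classH) : FanSumsBounded s := by
  refine fanSumsBounded_of_edgeDiamond_le hs.1 (C := Real.sqrt (∑' e, diamond s e ^ 2)) fun γ => ?_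
  rw [← diamond_fan_zero]
  exact Real.abs_le_sqrt (hs.2.le_tsum _ fun _ _ => sq_nonneg _)

end FareyShear

namespace FareyShear

open ModularGroup (S T)

/-! ### The developing map of a shear function -/

/-- This relation closes up the frames around a Farey triangle; the developing map needs it to be
consistent to the left of `-1`. -/
lemma T_mul_S_mul_T : T * S * T * S * T = S := by
  apply Subtype.ext
  simp only [Matrix.SpecialLinearGroup.coe_mul, ModularGroup.coe_S, ModularGroup.coe_T]
  simp

lemma S_mul_S_comm (γ : SL(2, ℤ)) : S * S * γ = γ * (S * S) := by
  have : S * S = -1 := by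
    apply Subtype.ext
    simp only [Matrix.SpecialLinearGroup.coe_mul, ModularGroup.coe_S]
    ext i j
    fin_cases i <;> fin_cases j <;> simp
  rw [this]
  simp

/-- The developing map of the shears `σ` on the positive half-line, as seen from the frame `γ`,
truncated after `k` steps in the Farey tree. -/
noncomputable def devApprox (σ : SL(2, ℤ) → ℝ) : ℕ → SL(2, ℤ) → ℚ → ℝ
  | 0, _, x => x
  | k + 1, γ, x => Real.exp (σ γ) * if 1 ≤ x then 1 + devApprox σ k (γ * T) (x - 1) else
      devApprox σ k (γ * T * S * T) (x / (1 - x)) /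
        (1 + devApprox σ k (γ * T * S * T) (x / (1 - x)))

section

variable {σ : SL(2, ℤ) → ℝ}

lemma devApprox_zero (k : ℕ) (γ : SL(2, ℤ)) : devApprox σ k γ 0 = 0 := by
  induction k generalizing γ with
  | zero => simp [devApprox]
  | succ k ih => simp [devApprox, ih]

lemma div_one_sub_lt {x y : ℚ} (hxy : x < y) (hy : y < 1) :
    x / (1 - x) < y / (1 - y) := by
  rw [div_lt_div_iff₀ (by linarith) (by linarith)]
  linarith

lemma div_one_add_lt {x y : ℝ} (hx : 0 ≤ x) (hxy : x < y) : x / (1 + x) < y / (1 + y) := by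
  rw [div_lt_div_iff₀ (by linarith) (by linarith)]
  linarith

lemma devApprox_strictMonoOn (k : ℕ) (γ : SL(2, ℤ)) :
    StrictMonoOn (devApprox σ k γ) (Set.Ici 0) := by
  induction k generalizing γ with
  | zero => exact fun x _ y _ hxy => by simpa [devApprox] using hxy
  | succ k ih =>
    have nonneg : ∀ (γ : SL(2, ℤ)) {x : ℚ}, 0 ≤ x → 0 ≤ devApprox σ k γ x := fun γ x hx => by
      simpa [devApprox_zero] using (ih γ).monotoneOn (Set.mem_Ici.mpr le_rfl) hx hx
    intro x hx y hy hxy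
    have hx : 0 ≤ x := hx
    have hy : 0 ≤ y := hy
    refine mul_lt_mul_of_pos_left ?_ (Real.exp_pos _)
    by_cases hy1 : 1 ≤ y
    · rw [if_pos hy1]
      by_cases hx1 : 1 ≤ x
      · rw [if_pos hx1]
        exact add_lt_add_right (ih _ (sub_nonneg.mpr hx1) (sub_nonneg.mpr hy1) (by linarith)) 1
      · rw [if_neg hx1]
        have h1 := nonneg (γ * T * S * T) (div_nonneg hx (by linarith : 0 ≤ 1 - x))
        have h2 := nonneg (γ * T) (sub_nonneg.mpr hy1)
        refine lt_of_lt_of_le ?_ (le_add_of_nonneg_right h2)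
        rw [div_lt_one (by linarith)]
        linarith
    · rw [if_neg hy1, if_neg (by linarith)]
      have h1 : 0 ≤ x / (1 - x) := div_nonneg hx (by linarith)
      have h2 := div_one_sub_lt hxy (not_le.mp hy1)
      exact div_one_add_lt (nonneg _ h1) (ih _ h1 (h1.trans h2.le) h2)

/-- The recursion is the subtractive Euclidean algorithm: `a / b` becomes `(a - b) / b` or `a / (b -
a)`. For `a > 0` the sum `a + b` drops at each step, so `a + b` steps suffice; `0` is fixed at every
depth and is treated separately. -/
lemma devApprox_succ_eq (k : ℕ) (γ : SL(2, ℤ)) {a b : ℕ} (hb : 0 < b) (hk : a + b ≤ k) :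
    devApprox σ (k + 1) γ (a / b) = devApprox σ k γ (a / b) := by
  induction k generalizing γ a b with
  | zero => omega
  | succ k ih =>
    have hb' : (0 : ℚ) < b := by exact_mod_cast hb
    rcases Nat.eq_zero_or_pos a with rfl | ha
    · simp [devApprox_zero]
    rw [devApprox.eq_2 σ γ _ (k + 1), devApprox.eq_2 σ γ _ k]
    by_cases h : (1 : ℚ) ≤ a / b
    · rw [if_pos h, if_pos h]
      rw [one_le_div hb'] at h
      have h' : b ≤ a := by exact_mod_cast h
      rw [show (a : ℚ) / b - 1 = ((a - b : ℕ) : ℚ) / b by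
        rw [Nat.cast_sub h', sub_div, div_self hb'.ne'], ih _ hb (by omega)]
    · rw [if_neg h, if_neg h]
      rw [one_le_div hb', not_le] at h
      have h' : a < b := by exact_mod_cast h
      have : (a : ℚ) / b / (1 - a / b) = (a : ℚ) / ((b - a : ℕ) : ℚ) := by
        have : (b : ℚ) - a ≠ 0 := by linarith
        rw [Nat.cast_sub h'.le]
        field_simp
      rw [this, ih _ (by omega) (by omega)]

lemma devApprox_congr {γ γ' : SL(2, ℤ)} (h : ∀ δ, σ (γ * δ) = σ (γ' * δ)) (k : ℕ) (x : ℚ) :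
    devApprox σ k γ x = devApprox σ k γ' x := by
  induction k generalizing γ γ' x with
  | zero => rfl
  | succ k ih =>
    rw [devApprox, devApprox, ih (γ := γ * T) (γ' := γ' * T) (fun δ => by simp only [mul_assoc, h]),
      ih (γ := γ * T * S * T) (γ' := γ' * T * S * T) (fun δ => by simp only [mul_assoc, h])]
    have := h 1
    rw [mul_one, mul_one] at this
    rw [this]

/-- The developing map of `σ` on the positive half-line, as seen from the frame `γ`. -/
noncomputable def devPos (σ : SL(2, ℤ) → ℝ) (γ : SL(2, ℤ)) (x : ℚ) : ℝ :=
  devApprox σ (x.num.natAbs + x.den) γ x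

lemma devApprox_eq_devPos (γ : SL(2, ℤ)) {x : ℚ} (hx : 0 ≤ x) {k : ℕ}
    (hk : x.num.natAbs + x.den ≤ k) : devApprox σ k γ x = devPos σ γ x := by
  have e : x = (x.num.natAbs : ℚ) / x.den := by
    have h1 : (x.num.natAbs : ℤ) = x.num := Int.natAbs_of_nonneg (Rat.num_nonneg.mpr hx)
    have h2 : (x.num.natAbs : ℚ) = x.num := by rw [← Int.cast_natCast, h1]
    rw [h2, Rat.num_div_den]
  induction k, hk using Nat.le_induction with
  | base => rfl
  | succ k hk ih =>
    rw [← ih]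
    conv_lhs => rw [e]
    conv_rhs => rw [e]
    exact devApprox_succ_eq k γ x.den_pos hk

lemma devPos_zero (γ : SL(2, ℤ)) : devPos σ γ 0 = 0 := devApprox_zero _ _

lemma devPos_strictMonoOn (γ : SL(2, ℤ)) : StrictMonoOn (devPos σ γ) (Set.Ici 0) := by
  intro x hx y hy hxy
  rw [← devApprox_eq_devPos γ hx (le_max_left _ (y.num.natAbs + y.den)),
    ← devApprox_eq_devPos γ hy (le_max_right (x.num.natAbs + x.den) _)]
  exact devApprox_strictMonoOn _ _ hx hy hxy

lemma devPos_pos (γ : SL(2, ℤ)) {x : ℚ} (hx : 0 < x) : 0 < devPos σ γ x := by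
  simpa only [devPos_zero] using
    devPos_strictMonoOn (σ := σ) γ (Set.mem_Ici.mpr le_rfl) (Set.mem_Ici.mpr hx.le) hx

lemma devPos_nonneg (γ : SL(2, ℤ)) {x : ℚ} (hx : 0 ≤ x) : 0 ≤ devPos σ γ x := by
  rcases hx.eq_or_lt with rfl | hx
  · rw [devPos_zero]
  · exact (devPos_pos γ hx).le

lemma devPos_add_one (γ : SL(2, ℤ)) {x : ℚ} (hx : 0 ≤ x) :
    devPos σ γ (x + 1) = Real.exp (σ γ) * (1 + devPos σ (γ * T) x) := by
  set k := max ((x + 1).num.natAbs + (x + 1).den) (x.num.natAbs + x.den)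
  rw [← devApprox_eq_devPos γ (by linarith) ((le_max_left _ _).trans (Nat.le_succ k)),
    ← devApprox_eq_devPos (γ * T) hx (le_max_right _ _ : _ ≤ k), devApprox, if_pos (by linarith),
    add_sub_cancel_right]

/-- Here `x ↦ x / (1 - x)` is the inverse of the action `x ↦ x / (x + 1)` of `T S T`. -/
lemma devPos_of_lt_one (γ : SL(2, ℤ)) {x : ℚ} (hx : 0 ≤ x) (hx1 : x < 1) :
    devPos σ γ x = Real.exp (σ γ) * (devPos σ (γ * T * S * T) (x / (1 - x)) /
      (1 + devPos σ (γ * T * S * T) (x / (1 - x)))) := by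
  have hy : 0 ≤ x / (1 - x) := div_nonneg hx (by linarith)
  set y := x / (1 - x) with hydef
  set k := max (x.num.natAbs + x.den) (y.num.natAbs + y.den)
  rw [← devApprox_eq_devPos γ hx ((le_max_left _ _).trans (Nat.le_succ k)),
    ← devApprox_eq_devPos _ hy (le_max_right _ _ : _ ≤ k), devApprox, if_neg (by linarith)]

lemma devPos_congr {γ γ' : SL(2, ℤ)} (h : ∀ δ, σ (γ * δ) = σ (γ' * δ)) (x : ℚ) :
    devPos σ γ x = devPos σ γ' x := devApprox_congr h _ _

/-- The developing map of the shears `σ`, as seen from the frame `γ`. -/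
noncomputable def dev (σ : SL(2, ℤ) → ℝ) (γ : SL(2, ℤ)) (x : ℚ) : ℝ :=
  if 0 ≤ x then devPos σ γ x else -Real.exp (σ γ) / devPos σ (γ * S) (-1 / x)

lemma dev_zero (γ : SL(2, ℤ)) : dev σ γ 0 = 0 := by simp [dev, devPos_zero]

lemma dev_one (γ : SL(2, ℤ)) : dev σ γ 1 = Real.exp (σ γ) := by
  have := devPos_add_one (σ := σ) γ le_rfl
  rw [zero_add, devPos_zero, add_zero, mul_one] at this
  rw [dev, if_pos zero_le_one, this]

lemma dev_strictMono (γ : SL(2, ℤ)) : StrictMono (dev σ γ) := by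
  intro x y hxy
  have hpos : ∀ {z : ℚ}, z < 0 → 0 < -1 / z := fun hz => div_pos_of_neg_of_neg (by norm_num) hz
  have he := Real.exp_pos (σ γ)
  by_cases hx : 0 ≤ x
  · have hy := hx.trans hxy.le
    rw [dev, dev, if_pos hx, if_pos hy]
    exact devPos_strictMonoOn γ hx hy hxy
  · have hx' := not_le.mp hx
    have p1 := devPos_pos (σ := σ) (γ * S) (hpos hx')
    rw [dev, dev, if_neg hx]
    split_ifs with hy
    · exact (div_neg_of_neg_of_pos (by linarith) p1).trans_le (devPos_nonneg γ hy)
    · have hy' := not_le.mp hy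
      have hlt : -1 / x < -1 / y := by
        rw [neg_div, neg_div, neg_lt_neg_iff]; exact one_div_lt_one_div_of_neg_of_lt hy' hxy
      have := devPos_strictMonoOn (σ := σ) (γ * S) (hpos hx').le (hpos hy').le hlt
      rw [neg_div (devPos _ _ _), neg_div (devPos _ _ _), neg_lt_neg_iff]
      exact div_lt_div_of_pos_left he p1 this

/-! ### Equivariance of the developing map under the generators -/

variable (hσ : ∀ γ, σ (γ * S) = σ γ)
include hσ

lemma devPos_mul_S_mul_S (γ : SL(2, ℤ)) (x : ℚ) : devPos σ (γ * S * S) x = devPos σ γ x := by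
  refine devPos_congr (fun δ => ?_) x
  rw [mul_assoc γ, mul_assoc γ, S_mul_S_comm, ← mul_assoc, ← mul_assoc, hσ, hσ]

lemma dev_neg_one (γ : SL(2, ℤ)) : dev σ γ (-1) = -1 := by
  rw [dev, if_neg (by norm_num), show (-1 : ℚ) / -1 = 0 + 1 by norm_num, devPos_add_one _ le_rfl,
    devPos_zero, hσ, add_zero, mul_one, neg_div, div_self (Real.exp_pos _).ne']

lemma dev_neg_inv (γ : SL(2, ℤ)) {x : ℚ} (hx : x ≠ 0) :
    dev σ γ (-1 / x) = -Real.exp (σ γ) / dev σ (γ * S) x := by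
  have he := (Real.exp_pos (σ γ)).ne'
  rcases hx.lt_or_gt with h | h
  · have h' : 0 < -1 / x := div_pos_of_neg_of_neg (by norm_num) h
    rw [dev, dev, if_pos h'.le, if_neg (by linarith), devPos_mul_S_mul_S hσ, hσ]
    have := (devPos_pos (σ := σ) γ h').ne'
    field_simp
  · have h' : -1 / x < 0 := div_neg_of_neg_of_pos (by norm_num) h
    rw [dev, dev, if_neg (by linarith), if_pos h.le]
    congr 2
    field_simp

/-- For `x ≥ 0` this is the recursion. For negative `x` it is the compatibility of the recursion
with the inversion used to define `dev` on the negative half-line, which rests on `σ (γ * S) = σ γ`.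
-/
lemma dev_add_one (γ : SL(2, ℤ)) (x : ℚ) :
    dev σ γ (x + 1) = Real.exp (σ γ) * (1 + dev σ (γ * T) x) := by
  have he := (Real.exp_pos (σ γ)).ne'
  have he' := (Real.exp_pos (σ (γ * T))).ne'
  by_cases hx : 0 ≤ x
  · rw [dev, dev, if_pos hx, if_pos (by linarith), devPos_add_one γ hx]
  · rw [not_le] at hx
    rw [dev, dev, if_neg (not_le.mpr hx)]
    by_cases hx1 : 0 ≤ x + 1
    · have hu : 0 ≤ -1 / x - 1 := by
        rw [sub_nonneg, le_div_iff_of_neg hx]; linarith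
      have h1 : (x + 1) / (1 - (x + 1)) = -1 / x - 1 := by
        have : x ≠ 0 := hx.ne
        rw [show 1 - (x + 1) = -x by ring]
        field_simp
        ring
      have h2 := devPos_add_one (σ := σ) (γ * T * S) hu
      rw [sub_add_cancel, hσ] at h2
      have hP := devPos_nonneg (σ := σ) (γ * T * S * T) hu
      rw [if_pos hx1, devPos_of_lt_one γ hx1 (by linarith), h1, h2]
      set P := devPos σ (γ * T * S * T) (-1 / x - 1)
      have : 1 + P ≠ 0 := by positivity
      field_simp
      ring
    · rw [not_le] at hx1
      have hu : 0 ≤ -1 / x := (div_pos_of_neg_of_neg (by norm_num) hx).le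
      have hu1 : -1 / x < 1 := by rw [div_lt_iff_of_neg hx]; linarith
      have h1 : -1 / x / (1 - -1 / x) = -1 / (x + 1) := by
        have : x ≠ 0 := hx.ne
        have : x + 1 ≠ 0 := hx1.ne
        have : 1 - -1 / x = (x + 1) / x := by field_simp; ring
        rw [this]
        field_simp
      have h2 := devPos_of_lt_one (σ := σ) (γ * T * S) hu hu1
      -- For `x < -1` the route through `γ T S` returns to the frame `γ S` around the triangle.
      have h3 : γ * T * S * T * S * T = γ * S := by
        conv_rhs => rw [← T_mul_S_mul_T]
        simp only [mul_assoc]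
      rw [h1, hσ, h3] at h2
      have hP := devPos_pos (σ := σ) (γ * S)
        (div_pos_of_neg_of_neg (by norm_num : (-1 : ℚ) < 0) hx1)
      rw [if_neg (not_le.mpr hx1), h2]
      set P := devPos σ (γ * S) (-1 / (x + 1))
      have : 1 + P ≠ 0 := by positivity
      have := hP.ne'
      field_simp
      ring

end

end FareyShear

namespace FareyShear

open ModularGroup (S T)

/-! ### Density of the range of the developing map -/

section

variable {σ : SL(2, ℤ) → ℝ} {M : ℝ}

/-- Each step of `dev_add_one` multiplies the scale by `exp (σ (γ * T ^ i))`, so the logarithm of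
the total scale is a fan sum. -/
lemma exists_dev_add_natCast (hσ : ∀ γ, σ (γ * S) = σ γ)
    (hM : ∀ (γ : SL(2, ℤ)) (n m : ℤ), n ≤ m → |∑ i ∈ Finset.Icc n m, σ (γ * T ^ i)| ≤ M)
    (γ : SL(2, ℤ)) (n : ℕ) : ∃ l : ℝ, |l| ≤ M ∧
      ∀ x : ℚ, dev σ γ (x + n) = dev σ γ n + Real.exp l * dev σ (γ * T ^ n) x := by
  have key : ∀ n : ℕ, ∀ x : ℚ, dev σ γ (x + n) = dev σ γ n +
      Real.exp (∑ i ∈ Finset.range n, σ (γ * T ^ i)) * dev σ (γ * T ^ n) x := by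
    intro n
    induction n with
    | zero => intro x; simp [dev_zero]
    | succ n ih =>
      have step : ∀ x : ℚ, dev σ γ (x + (n + 1 : ℕ)) = dev σ γ n +
          Real.exp (∑ i ∈ Finset.range (n + 1), σ (γ * T ^ i)) *
            (1 + dev σ (γ * T ^ (n + 1)) x) := by
        intro x
        rw [show x + ((n + 1 : ℕ) : ℚ) = (x + 1) + n by push_cast; ring, ih, dev_add_one hσ,
          Finset.sum_range_succ, Real.exp_add, pow_succ, mul_assoc γ]
        ring
      intro x
      have h0 := step 0
      rw [zero_add, dev_zero] at h0
      rw [step, h0]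
      ring
  refine ⟨_, ?_, key n⟩
  rcases Nat.eq_zero_or_pos n with rfl | hn
  · simpa using (abs_nonneg _).trans (hM 1 0 0 le_rfl)
  · have := hM γ 0 ((n : ℤ) - 1) (by omega)
    convert this using 2
    refine Finset.sum_nbij (fun i : ℕ => (i : ℤ)) ?_ ?_ ?_ ?_
    · intro i hi
      simp only [Finset.mem_range] at hi
      simp only [Finset.mem_Icc]
      omega
    · exact fun i _ j _ h => Nat.cast_injective (R := ℤ) h
    · intro j hj
      simp only [Finset.coe_Icc, Set.mem_Icc] at hj
      exact ⟨j.toNat, by simp; omega, by simp; omega⟩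
    · intro i _
      rw [zpow_natCast]

lemma exists_dev_add_intCast (hσ : ∀ γ, σ (γ * S) = σ γ)
    (hM : ∀ (γ : SL(2, ℤ)) (n m : ℤ), n ≤ m → |∑ i ∈ Finset.Icc n m, σ (γ * T ^ i)| ≤ M)
    (γ : SL(2, ℤ)) (n : ℤ) : ∃ l : ℝ, |l| ≤ M ∧
      ∀ x : ℚ, dev σ γ (x + n) = dev σ γ n + Real.exp l * dev σ (γ * T ^ n) x := by
  obtain ⟨m, rfl | rfl⟩ := n.eq_nat_or_neg
  · simpa using exists_dev_add_natCast hσ hM γ m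
  -- A backward translation is obtained by inverting the forward one that starts at `γ T ^ (-m)`.
  · obtain ⟨l, hl, h⟩ := exists_dev_add_natCast hσ hM (γ * T ^ (-(m : ℤ))) m
    refine ⟨-l, by rwa [abs_neg], fun x => ?_⟩
    have e : γ * T ^ (-(m : ℤ)) * T ^ m = γ := by
      rw [mul_assoc, ← zpow_natCast, ← zpow_add, neg_add_cancel, zpow_zero, mul_one]
    rw [e] at h
    have h1 := h (x + (-(m : ℤ) : ℤ))
    have h0 := h ((-(m : ℤ) : ℤ) : ℚ)
    push_cast at h1 h0 ⊢
    rw [neg_add_cancel, dev_zero] at h0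
    rw [neg_add_cancel_right] at h1
    have hE : Real.exp l * Real.exp (-l) = 1 := by rw [← Real.exp_add]; simp
    have hl0 := (Real.exp_pos l).ne'
    apply mul_left_cancel₀ hl0
    linear_combination h0 - h1 - dev σ (γ * T ^ (-(m : ℤ))) x * hE

variable (hσ : ∀ γ, σ (γ * S) = σ γ)
  (hM : ∀ (γ : SL(2, ℤ)) (n m : ℤ), n ≤ m → |∑ i ∈ Finset.Icc n m, σ (γ * T ^ i)| ≤ M)
include hσ hM

/-- The developing map as seen from two edges of the same fan. -/
lemma exists_dev_shift (γ : SL(2, ℤ)) (n : ℤ) : ∃ l : ℝ, 0 < l ∧ l ≤ Real.exp M ∧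
    1 ≤ Real.exp M * l ∧ dev σ γ (n - 1) = dev σ γ n - l ∧
      ∀ x : ℚ, dev σ γ (x + n) = dev σ γ n + l * dev σ (γ * T ^ n) x := by
  obtain ⟨l, hl, h⟩ := exists_dev_add_intCast hσ hM γ n
  rw [abs_le] at hl
  refine ⟨Real.exp l, Real.exp_pos l, Real.exp_le_exp.mpr hl.2, ?_, ?_, h⟩
  · rw [← Real.exp_add]; exact Real.one_le_exp (by linarith)
  · have := h (-1)
    rw [dev_neg_one hσ, neg_add_eq_sub] at this
    rw [this]
    ring

/-- Each unit step at the integers has image length at least `exp (-M)`. So the images of the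
integers are unbounded in both directions, and no gap reaches `∞`. -/
lemma dev_intCast_growth (γ : SL(2, ℤ)) {n m : ℤ} (h : n ≤ m) :
    (m - n : ℝ) ≤ Real.exp M * (dev σ γ m - dev σ γ n) := by
  induction m, h using Int.leInduction with
  | base => simp
  | succ k hk ih =>
    obtain ⟨l, -, -, h1, h2, -⟩ := exists_dev_shift hσ hM γ (k + 1)
    push_cast at h2 ⊢
    rw [add_sub_cancel_right] at h2
    have := mul_le_mul_of_nonneg_left ih zero_le_one
    have e : dev σ γ (k + 1) = dev σ γ k + l := by linarith
    rw [e]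
    linarith

/-! ### Gaps of the range and their renormalization -/

/-- The open interval `(α, β)` is disjoint from the range of the developing map. -/
def IsGap (σ : SL(2, ℤ) → ℝ) (γ : SL(2, ℤ)) (α β : ℝ) : Prop :=
  α < β ∧ ∀ x : ℚ, dev σ γ x ≤ α ∨ β ≤ dev σ γ x

omit hσ hM in
lemma IsGap.shift {γ γ' : SL(2, ℤ)} {α β l : ℝ} (hg : IsGap σ γ α β) (hl : 0 < l) {n : ℚ}
    (h : ∀ x : ℚ, dev σ γ (x + n) = dev σ γ n + l * dev σ γ' x) :
    IsGap σ γ' ((α - dev σ γ n) / l) ((β - dev σ γ n) / l) := by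
  refine ⟨by gcongr; exact hg.1, fun x => ?_⟩
  have := hg.2 (x + n)
  rw [h] at this
  rw [le_div_iff₀ hl, div_le_iff₀ hl]
  rcases this with h | h
  · left; linarith
  · right; linarith

omit hM in
-- The map `y ↦ -exp (σ γ) / y` is increasing on each half-line, so a gap that avoids `0` is carried
-- to a gap of the frame `γ S` with its ends in order.
lemma IsGap.inv_pos {γ : SL(2, ℤ)} {α β : ℝ} (hg : IsGap σ γ α β) (hα : 0 < α) :
    IsGap σ (γ * S) (-Real.exp (σ γ) / α) (-Real.exp (σ γ) / β) := by
  have he := Real.exp_pos (σ γ)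
  have hβ := hα.trans hg.1
  have hm := dev_strictMono (σ := σ)
  refine ⟨?_, fun x => ?_⟩
  · rw [neg_div, neg_div, neg_lt_neg_iff]
    exact div_lt_div_of_pos_left he hα hg.1
  rcases le_or_gt 0 x with hx | hx
  · right
    have := (hm (γ * S)).monotone hx
    rw [dev_zero] at this
    exact (div_neg_of_neg_of_pos (by linarith) hβ).le.trans this
  · have hpos := hm γ (div_pos_of_neg_of_neg (by norm_num : (-1 : ℚ) < 0) hx)
    have hneg := hm (γ * S) hx
    rw [dev_zero] at hpos hneg
    have h1 := dev_neg_inv hσ γ hx.ne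
    have h2 : dev σ (γ * S) x = -Real.exp (σ γ) / dev σ γ (-1 / x) := by
      rw [h1]
      field_simp
    rw [h2, neg_div (dev _ _ _), neg_div α, neg_div β, neg_le_neg_iff, neg_le_neg_iff]
    rcases hg.2 (-1 / x) with h | h
    · left; exact div_le_div_of_nonneg_left he.le hpos h
    · right; exact div_le_div_of_nonneg_left he.le hβ h

omit hM in
lemma IsGap.inv_neg {γ : SL(2, ℤ)} {α β : ℝ} (hg : IsGap σ γ α β) (hβ : β < 0) :
    IsGap σ (γ * S) (-Real.exp (σ γ) / α) (-Real.exp (σ γ) / β) := by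
  have he := Real.exp_pos (σ γ)
  have hα := hg.1.trans hβ
  have hm := dev_strictMono (σ := σ)
  have key : ∀ {a b : ℝ}, a ≤ b → b < 0 → -Real.exp (σ γ) / a ≤ -Real.exp (σ γ) / b := by
    intro a b hab hb
    rw [← neg_div_neg_eq, ← neg_div_neg_eq _ b, neg_neg]
    exact div_le_div_of_nonneg_left he.le (by linarith) (by linarith)
  refine ⟨?_, fun x => ?_⟩
  · rw [← neg_div_neg_eq, ← neg_div_neg_eq _ β, neg_neg]
    exact div_lt_div_of_pos_left he (by linarith) (by linarith [hg.1])
  rcases le_or_gt x 0 with hx | hx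
  · left
    have := (hm (γ * S)).monotone hx
    rw [dev_zero] at this
    exact this.trans (div_pos_of_neg_of_neg (by linarith) hα).le
  · have hneg := hm γ (div_neg_of_neg_of_pos (by norm_num : (-1 : ℚ) < 0) hx)
    have hpos := hm (γ * S) hx
    rw [dev_zero] at hpos hneg
    have h1 := dev_neg_inv hσ γ hx.ne'
    have h2 : dev σ (γ * S) x = -Real.exp (σ γ) / dev σ γ (-1 / x) := by
      rw [h1]
      field_simp
    rw [h2]
    rcases hg.2 (-1 / x) with h | h
    · left; exact key h hα
    · right; exact key h hneg

/-- By inversion, the growth at the integers says that the images of the points `1 / n` tend to `0`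
from above, so `0` is not the left end of a gap. -/
lemma IsGap.left_pos {γ : SL(2, ℤ)} {α β : ℝ} (hg : IsGap σ γ α β) (hα : 0 ≤ α) : 0 < α := by
  refine hα.lt_of_ne' fun h0 => ?_
  subst h0
  have hβ := hg.1
  have he := Real.exp_pos (σ γ)
  have hK := Real.exp_pos M
  obtain ⟨n, hn⟩ := exists_nat_gt (Real.exp (σ γ) * Real.exp M / β)
  have hn0 : (0 : ℝ) < n := lt_of_le_of_lt (by positivity) hn
  have hnq : (0 : ℚ) < n := by exact_mod_cast hn0
  have h1 := dev_neg_inv hσ γ (neg_ne_zero.mpr hnq.ne')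
  have h2 := dev_intCast_growth hσ hM (γ * S) (n := -(n : ℤ)) (m := 0) (by omega)
  push_cast at h2
  rw [dev_zero, zero_sub, zero_sub, neg_neg] at h2
  have hneg : 0 < -dev σ (γ * S) (-(n : ℚ)) := by
    by_contra! h
    have := mul_nonpos_of_nonneg_of_nonpos hK.le h
    linarith
  have h3 : dev σ γ (-1 / -(n : ℚ)) = Real.exp (σ γ) / (-dev σ (γ * S) (-(n : ℚ))) := by
    rw [h1, ← neg_div_neg_eq, neg_neg]
  rcases hg.2 (-1 / -(n : ℚ)) with h | h
  · rw [h3] at h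
    exact absurd (div_pos he hneg) (not_lt.mpr h)
  · rw [h3, le_div_iff₀ hneg] at h
    rw [div_lt_iff₀ hβ] at hn
    have h4 : Real.exp M * (β * -dev σ (γ * S) (-(n : ℚ))) ≤ Real.exp M * Real.exp (σ γ) :=
      mul_le_mul_of_nonneg_left h hK.le
    have h5 := mul_le_mul_of_nonneg_left h2 hβ.le
    linarith

/-- The mirror image: the images of `-1 / n` tend to `0` from below. -/
lemma IsGap.right_neg {γ : SL(2, ℤ)} {α β : ℝ} (hg : IsGap σ γ α β) (hβ : β ≤ 0) : β < 0 := by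
  refine hβ.lt_of_ne fun h0 => ?_
  subst h0
  have hα := hg.1
  have he := Real.exp_pos (σ γ)
  have hK := Real.exp_pos M
  obtain ⟨n, hn⟩ := exists_nat_gt (Real.exp (σ γ) * Real.exp M / (-α))
  have hn0 : (0 : ℝ) < n := lt_of_le_of_lt (div_nonneg (by positivity) (by linarith)) hn
  have hnq : (0 : ℚ) < n := by exact_mod_cast hn0
  have h1 := dev_neg_inv hσ γ hnq.ne'
  have h2 := dev_intCast_growth hσ hM (γ * S) (n := 0) (m := (n : ℤ)) (by omega)
  push_cast at h2
  rw [dev_zero, sub_zero, sub_zero] at h2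
  have hpos : 0 < dev σ (γ * S) (n : ℚ) := by
    by_contra! h
    have := mul_nonpos_of_nonneg_of_nonpos hK.le h
    linarith
  rcases hg.2 (-1 / (n : ℚ)) with h | h
  · rw [h1, div_le_iff₀ hpos] at h
    rw [div_lt_iff₀ (by linarith)] at hn
    have h4 : Real.exp M * -(α * dev σ (γ * S) (n : ℚ)) ≤ Real.exp M * Real.exp (σ γ) :=
      mul_le_mul_of_nonneg_left (by linarith) hK.le
    have h5 := mul_le_mul_of_nonneg_left h2 (by linarith : 0 ≤ -α)
    linarith
  · rw [h1] at h
    exact absurd (div_neg_of_neg_of_pos (by linarith : -Real.exp (σ γ) < 0) hpos) (not_lt.mpr h)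

lemma exists_dev_intCast_le (γ : SL(2, ℤ)) (y : ℝ) :
    ∃ n : ℤ, dev σ γ n ≤ y ∧ y < dev σ γ (n + 1) := by
  have hK := Real.exp_pos M
  obtain ⟨N, hN⟩ := exists_nat_gt (Real.exp M * |y|)
  have hupper : ∀ z : ℤ, dev σ γ z ≤ y → z ≤ N := by
    intro z hz
    by_contra! hlt
    have h1 := dev_intCast_growth hσ hM γ (n := 0) (m := z) (by omega)
    push_cast at h1
    rw [dev_zero, sub_zero, sub_zero] at h1
    have h2 : (N : ℝ) < z := by exact_mod_cast hlt
    have h3 := mul_le_mul_of_nonneg_left (hz.trans (le_abs_self y)) hK.le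
    linarith
  have hne : ∃ z : ℤ, dev σ γ z ≤ y := by
    refine ⟨-(N : ℤ), ?_⟩
    by_contra! hlt
    have h1 := dev_intCast_growth hσ hM γ (n := -(N : ℤ)) (m := 0) (by omega)
    push_cast at h1 hlt
    rw [dev_zero, zero_sub, zero_sub, neg_neg] at h1
    have h3 := mul_le_mul_of_nonneg_left ((neg_lt_neg hlt).le.trans (neg_le_abs y)) hK.le
    linarith
  obtain ⟨n, hn, hmax⟩ := Int.exists_greatest_of_bdd ⟨(N : ℤ), hupper⟩ hne
  refine ⟨n, hn, ?_⟩
  by_contra! h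
  have := hmax (n + 1) (by push_cast; exact h)
  omega

/-- From a gap we obtain another one that is larger, in a scale-invariant sense. -/
lemma IsGap.exists_larger {γ : SL(2, ℤ)} {α β : ℝ} (hg : IsGap σ γ α β) (hα : 0 < α) :
    ∃ (γ' : SL(2, ℤ)) (α' β' : ℝ), IsGap σ γ' α' β' ∧ 0 < α' ∧
      (β - α) / β ≤ Real.exp M / (1 + Real.exp M) * ((β' - α') / β') := by
  have hK := Real.exp_pos M
  have hm := dev_strictMono (σ := σ)
  have hσM : ∀ γ, Real.exp (σ γ) ≤ Real.exp M := fun γ => by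
    have := hM γ 0 0 le_rfl
    rw [Finset.Icc_self, Finset.sum_singleton, zpow_zero, mul_one] at this
    exact Real.exp_le_exp.mpr (le_of_abs_le this)
  obtain ⟨n, hn, hn'⟩ := exists_dev_intCast_le hσ hM γ α
  have hβn : β ≤ dev σ γ (n + 1) :=
    (hg.2 _).resolve_left (not_le.mpr hn')
  have hn0 : 0 ≤ n := by
    by_contra! h
    have h1 : (n : ℚ) + 1 ≤ 0 := by exact_mod_cast h
    have := (hm γ).monotone h1
    rw [dev_zero] at this
    linarith
  -- If the gap lies between the images of `0` and `1`, it is inverted, translated so that it lies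
  -- in `[-1, 0)`, and inverted again. Otherwise one translation to the last integer before it
  -- suffices.
  rcases hn0.eq_or_lt with h0 | hn1
  · subst h0
    rw [Int.cast_zero, zero_add, dev_one] at hβn
    have hβ := hα.trans hg.1
    have hE := Real.exp_pos (σ γ)
    have hg1 := hg.inv_pos hσ hα
    set α₁ := -Real.exp (σ γ) / α with hα₁
    set β₁ := -Real.exp (σ γ) / β with hβ₁
    have hβ1 : β₁ ≤ -1 := by
      rw [hβ₁, neg_div, neg_le_neg_iff, one_le_div hβ]
      exact hβn
    obtain ⟨k, hk, hk'⟩ := exists_dev_intCast_le hσ hM (γ * S) α₁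
    have hβk : β₁ ≤ dev σ (γ * S) (k + 1) := (hg1.2 _).resolve_left (not_le.mpr hk')
    have hk1 : k + 1 ≤ -1 := by
      by_contra! h
      have h1 : (-1 : ℚ) ≤ k := by
        have : -1 ≤ k := by omega
        exact_mod_cast this
      have := (hm (γ * S)).monotone h1
      rw [dev_neg_one hσ] at this
      linarith [hg1.1]
    obtain ⟨l, hl, hlM, -, hpred, hsh⟩ := exists_dev_shift hσ hM (γ * S) (k + 1)
    have hg2 := hg1.shift hl hsh
    push_cast at hg2 hpred
    rw [add_sub_cancel_right] at hpred
    have hN : dev σ (γ * S) (k + 1) ≤ -1 := by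
      have h1 : (k : ℚ) + 1 ≤ -1 := by exact_mod_cast hk1
      have := (hm (γ * S)).monotone h1
      rwa [dev_neg_one hσ] at this
    set D := dev σ (γ * S) (k + 1) with hD
    set α₂ := (α₁ - D) / l with hα₂
    set β₂ := (β₁ - D) / l with hβ₂
    have hβ2 : β₂ < 0 := hg2.right_neg hσ hM (div_nonpos_of_nonpos_of_nonneg (by linarith) hl.le)
    have hα2 : -1 ≤ α₂ := by
      rw [hα₂, le_div_iff₀ hl]; linarith
    have hαβ2 := hg2.1
    have hg3 := hg2.inv_neg hσ hβ2
    set E := Real.exp (σ (γ * S * T ^ (k + 1))) with hEdef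
    have hEp : 0 < E := Real.exp_pos _
    refine ⟨_, _, _, hg3, div_pos_of_neg_of_neg (by linarith) (by linarith), ?_⟩
    have e1 : (β - α) / β = (β₂ - α₂) / (-D / l - α₂) := by
      have h1 : -D / l - α₂ = -α₁ / l := by rw [hα₂]; ring
      have h2 : β₂ - α₂ = (β₁ - α₁) / l := by rw [hα₂, hβ₂]; ring
      rw [h1, h2, hα₁, hβ₁]
      field_simp
      ring
    have e2 : (-E / β₂ - -E / α₂) / (-E / β₂) = (β₂ - α₂) / -α₂ := by
      have : α₂ ≠ 0 := by linarith
      have := hβ2.ne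
      field_simp
      ring
    -- With `-α₂ ≤ 1` this gives `-α₂ ≤ exp M * (-D / l)`, so dropping `-D / l` from the denominator
    -- enlarges the relative size by the factor `(1 + exp M) / exp M` at least.
    have hμ : 1 ≤ Real.exp M * (-D / l) := by
      rw [← mul_div_assoc, one_le_div hl]
      nlinarith
    rw [e1, e2, div_mul_div_comm, div_le_div_iff₀ (by nlinarith) (by nlinarith)]
    have : 0 < β₂ - α₂ := by linarith
    have : (1 + Real.exp M) * (-α₂) ≤ Real.exp M * (-D / l - α₂) := by nlinarith
    nlinarith
  · obtain ⟨l, hl, hlM, -, hpred, hsh⟩ := exists_dev_shift hσ hM γ n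
    have hg1 := hg.shift hl hsh
    have hD : l ≤ dev σ γ n := by
      have h1 : (0 : ℚ) ≤ n - 1 := by
        have : 0 ≤ n - 1 := by omega
        exact_mod_cast this
      have := (hm γ).monotone h1
      rw [dev_zero] at this
      linarith
    have hsucc := hsh 1
    rw [dev_one, add_comm] at hsucc
    set D := dev σ γ n with hDdef
    set α₁ := (α - D) / l with hα₁
    set β₁ := (β - D) / l with hβ₁
    have hα1 : 0 < α₁ := hg1.left_pos hσ hM (div_nonneg (by linarith) hl.le)
    have hβ1 : β₁ ≤ Real.exp M := by
      rw [hβ₁, div_le_iff₀ hl]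
      nlinarith [hσM (γ * T ^ n)]
    have hαβ1 := hg1.1
    refine ⟨_, _, _, hg1, hα1, ?_⟩
    have e1 : (β - α) / β = (β₁ - α₁) / (D / l + β₁) := by
      have h1 : D / l + β₁ = β / l := by rw [hβ₁]; ring
      have h2 : β₁ - α₁ = (β - α) / l := by rw [hα₁, hβ₁]; ring
      have : β ≠ 0 := (hα.trans hg.1).ne'
      rw [h1, h2]
      field_simp
    -- The new relative size lacks the term `D / l` in its denominator. As `β₁ ≤ exp M`, this gains
    -- the same factor.
    have hμ : 1 ≤ D / l := by rwa [one_le_div hl]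
    rw [e1, div_mul_div_comm, div_le_div_iff₀ (by linarith) (by nlinarith)]
    have : 0 < β₁ - α₁ := by linarith
    have : (1 + Real.exp M) * β₁ ≤ Real.exp M * (D / l + β₁) := by nlinarith
    nlinarith

/-- Relative sizes of gaps are at most `1`, so iterating the enlargement `n` times bounds the
original one by `κ ^ n`. -/
lemma not_isGap_of_pos {γ : SL(2, ℤ)} {α β : ℝ} (hα : 0 < α) : ¬ IsGap σ γ α β := by
  intro hg
  have hK := Real.exp_pos M
  set κ := Real.exp M / (1 + Real.exp M) with hκ
  have hκ0 : 0 ≤ κ := by positivity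
  have hκ1 : κ < 1 := by rw [hκ, div_lt_one (by positivity)]; linarith
  have key : ∀ (n : ℕ) (γ : SL(2, ℤ)) (α β : ℝ), IsGap σ γ α β → 0 < α → (β - α) / β ≤ κ ^ n := by
    intro n
    induction n with
    | zero =>
      intro γ α β hg hα
      rw [pow_zero, div_le_one (hα.trans hg.1)]
      linarith
    | succ n ih =>
      intro γ α β hg hα
      obtain ⟨γ', α', β', hg', hα', hle⟩ := hg.exists_larger hσ hM hα
      rw [pow_succ']
      exact hle.trans (mul_le_mul_of_nonneg_left (ih γ' α' β' hg' hα') hκ0)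
  have h1 : (β - α) / β ≤ 0 :=
    ge_of_tendsto' (tendsto_pow_atTop_nhds_zero_of_lt_one hκ0 hκ1) fun n => key n γ α β hg hα
  have h2 : 0 < (β - α) / β := div_pos (by linarith [hg.1]) (hα.trans hg.1)
  linarith

/-- The developing map has dense range. -/
theorem dev_denseRange (γ : SL(2, ℤ)) : DenseRange (dev σ γ) := by
  refine dense_of_exists_between fun α β hαβ => ?_
  by_contra! h
  have hg : IsGap σ γ α β := by
    refine ⟨hαβ, fun x => ?_⟩
    by_contra! hx
    exact h _ ⟨x, rfl⟩ hx
  rcases lt_or_ge 0 β with hβ | hβ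
  -- A gap that meets the positive half-line is shortened to one with positive left end; a gap in
  -- the negative half-line is inverted.
  · refine not_isGap_of_pos hσ hM (γ := γ) (α := max α (β / 2)) (β := β)
      (lt_max_of_lt_right (by linarith)) ⟨max_lt hαβ (by linarith), fun x => ?_⟩
    exact (hg.2 x).imp_left fun h => h.trans (le_max_left _ _)
  · have hβ' := hg.right_neg hσ hM hβ
    exact not_isGap_of_pos hσ hM (div_pos_of_neg_of_neg (by linarith [Real.exp_pos (σ γ)])
      (hαβ.trans hβ')) (hg.inv_neg hσ hβ')

end

end FareyShear

namespace FareyShear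

open ModularGroup (S T)

/-! ### From the real line to the circle -/

/-- The extension by suprema is monotone with dense range, hence has no jumps. Continuity and
unboundedness in both directions make it surjective, and a further rational between two points makes
it strict. -/
lemma exists_orderIso_extending {f : ℚ → ℝ} (hm : StrictMono f) (hd : DenseRange f) :
    ∃ F : ℝ ≃o ℝ, ∀ q : ℚ, F q = f q := by
  set F : ℝ → ℝ := fun x => sSup (f '' {q | (q : ℝ) ≤ x}) with hF
  have hne : ∀ x : ℝ, (f '' {q | (q : ℝ) ≤ x}).Nonempty := fun x => by
    obtain ⟨q, hq⟩ := exists_rat_lt x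
    exact ⟨f q, q, hq.le, rfl⟩
  have hbdd : ∀ x : ℝ, BddAbove (f '' {q | (q : ℝ) ≤ x}) := fun x => by
    obtain ⟨r, hr⟩ := exists_rat_gt x
    refine ⟨f r, ?_⟩
    rintro _ ⟨q, hq, rfl⟩
    have hq : (q : ℝ) ≤ x := hq
    exact (hm (by exact_mod_cast hq.trans_lt hr)).le
  have hFq : ∀ q : ℚ, F q = f q := fun q => by
    refine IsGreatest.csSup_eq ⟨⟨q, le_refl (q : ℝ), rfl⟩, ?_⟩
    rintro _ ⟨r, hr, rfl⟩
    have hr : (r : ℝ) ≤ q := hr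
    exact hm.monotone (by exact_mod_cast hr)
  have hmono : Monotone F := fun x y hxy =>
    csSup_le_csSup (hbdd y) (hne x) (Set.image_mono fun q hq => le_trans hq hxy)
  have hstrict : StrictMono F := fun x y hxy => by
    obtain ⟨p, hxp, hpy⟩ := exists_rat_btwn hxy
    obtain ⟨r, hpr, hry⟩ := exists_rat_btwn hpy
    calc F x ≤ F p := hmono hxp.le
      _ = f p := hFq p
      _ < f r := hm (by exact_mod_cast hpr)
      _ = F r := (hFq r).symm
      _ ≤ F y := hmono hry.le
  have hsub : Set.range f ⊆ Set.range F := by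
    rintro _ ⟨q, rfl⟩
    exact ⟨q, hFq q⟩
  have hdF : DenseRange F := hd.mono hsub
  have hcont : Continuous F := hmono.continuous_of_denseRange hdF
  have hsurj : Function.Surjective F := by
    intro y
    obtain ⟨_, ⟨a, rfl⟩, h1⟩ := hdF.exists_lt y
    obtain ⟨_, ⟨b, rfl⟩, h2⟩ := hdF.exists_gt y
    exact mem_range_of_exists_le_of_exists_ge hcont ⟨a, h1.le⟩ ⟨b, h2.le⟩
  exact ⟨hstrict.orderIsoOfSurjective F hsurj, hFq⟩

/-- The Cayley transform as a homeomorphism. -/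
noncomputable def cayleyHomeo : OnePoint ℝ ≃ₜ Circle :=
  Continuous.homeoOfEquivCompactToT2
    (f := Equiv.ofBijective cayleyInv ⟨cayleyInv_injective, cayleyInv_surjective⟩)
    continuous_cayleyInv

/-- The homeomorphism of the circle that is `F` in the coordinate of the upper half-plane. -/
noncomputable def circleHomeo (F : ℝ ≃o ℝ) : Circle ≃ₜ Circle :=
  cayleyHomeo.symm.trans (F.toHomeomorph.onePointCongr.trans cayleyHomeo)

lemma circleHomeo_cayleyInv (F : ℝ ≃o ℝ) (x : ℝ) :
    circleHomeo F (cayleyInv x) = cayleyInv (F x) := by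
  have : cayleyHomeo.symm (cayleyInv x) = x := cayleyHomeo.symm_apply_apply (x : OnePoint ℝ)
  simp only [circleHomeo, Homeomorph.trans_apply, this]
  rfl

lemma circleHomeo_infty (F : ℝ ≃o ℝ) : circleHomeo F (cayleyInv ∞) = cayleyInv ∞ := by
  have : cayleyHomeo.symm (cayleyInv ∞) = ∞ := cayleyHomeo.symm_apply_apply (∞ : OnePoint ℝ)
  simp only [circleHomeo, Homeomorph.trans_apply, this]
  rfl

lemma exp_eq_cayleyInv {u : ℝ} (h0 : 0 < u) (h1 : u < 1) :
    Circle.exp (2 * Real.pi * u) = cayleyInv (Real.tan (Real.pi * u - Real.pi / 2) : ℝ) := by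
  have hpi := Real.pi_pos
  have hs : 0 < Real.sin (Real.pi * u) :=
    Real.sin_pos_of_pos_of_lt_pi (by positivity) (by nlinarith)
  refine Circle.ext ?_
  rw [exp_eq_homPt, show 2 * Real.pi * u / 2 = Real.pi * u by ring,
    ← cayleyInv_div _ (neg_ne_zero.mpr hs.ne'), Real.tan_eq_sin_div_cos, Real.sin_sub_pi_div_two,
    Real.cos_sub_pi_div_two, neg_div, div_neg]

/-- In the coordinate `u ↦ e^{2π i u}` on `[0, 1)`, the map that is `F` on the real line. -/
noncomputable def angleMap (F : ℝ ≃o ℝ) (u : ℝ) : ℝ :=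
  if u = 0 then 0 else 1 / 2 + Real.arctan (F (Real.tan (Real.pi * u - Real.pi / 2))) / Real.pi

lemma half_add_arctan_mem (y : ℝ) : 1 / 2 + Real.arctan y / Real.pi ∈ Set.Ioo (0 : ℝ) 1 := by
  have hpi := Real.pi_pos
  have h1 := Real.neg_pi_div_two_lt_arctan y
  have h2 := Real.arctan_lt_pi_div_two y
  constructor
  · have : -(1 / 2) < Real.arctan y / Real.pi := by rw [lt_div_iff₀ hpi]; linarith
    linarith
  · have : Real.arctan y / Real.pi < 1 / 2 := by rw [div_lt_iff₀ hpi]; linarith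
    linarith

lemma tan_half_add_arctan (y : ℝ) :
    Real.tan (Real.pi * (1 / 2 + Real.arctan y / Real.pi) - Real.pi / 2) = y := by
  have hpi := Real.pi_pos.ne'
  rw [show Real.pi * (1 / 2 + Real.arctan y / Real.pi) - Real.pi / 2 = Real.arctan y by
    field_simp; ring, Real.tan_arctan]

lemma half_add_arctan_tan {u : ℝ} (h0 : 0 < u) (h1 : u < 1) :
    1 / 2 + Real.arctan (Real.tan (Real.pi * u - Real.pi / 2)) / Real.pi = u := by
  have hpi := Real.pi_pos
  rw [Real.arctan_tan (by nlinarith) (by nlinarith)]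
  field_simp
  ring

lemma angleMap_of_pos (F : ℝ ≃o ℝ) {u : ℝ} (hu : 0 < u) : angleMap F u =
    1 / 2 + Real.arctan (F (Real.tan (Real.pi * u - Real.pi / 2))) / Real.pi :=
  if_neg hu.ne'

lemma angleMap_mem (F : ℝ ≃o ℝ) (u : ℝ) : angleMap F u ∈ Set.Ico (0 : ℝ) 1 := by
  unfold angleMap
  split_ifs
  · simp
  · exact Set.Ioo_subset_Ico_self (half_add_arctan_mem _)

lemma angleMap_lt (F : ℝ ≃o ℝ) {u v : ℝ} (hu : 0 ≤ u) (huv : u < v) (hv : v < 1) :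
    angleMap F u < angleMap F v := by
  have hpi := Real.pi_pos
  rw [angleMap_of_pos F (hu.trans_lt huv)]
  rcases hu.eq_or_lt with rfl | hu
  · rw [angleMap, if_pos rfl]
    exact (half_add_arctan_mem _).1
  · rw [angleMap_of_pos F hu]
    have : Real.tan (Real.pi * u - Real.pi / 2) < Real.tan (Real.pi * v - Real.pi / 2) :=
      Real.tan_lt_tan_of_lt_of_lt_pi_div_two (by nlinarith) (by nlinarith) (by nlinarith)
    have := Real.arctan_strictMono (F.strictMono this)
    gcongr

lemma exists_angleMap_eq (F : ℝ ≃o ℝ) {v : ℝ} (hv : 0 ≤ v) (hv1 : v < 1) :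
    ∃ u, 0 ≤ u ∧ u < 1 ∧ angleMap F u = v := by
  rcases hv.eq_or_lt with rfl | hv
  · exact ⟨0, le_rfl, one_pos, if_pos rfl⟩
  · have h := half_add_arctan_mem (F.symm (Real.tan (Real.pi * v - Real.pi / 2)))
    refine ⟨_, h.1.le, h.2, ?_⟩
    rw [angleMap_of_pos F h.1, tan_half_add_arctan, OrderIso.apply_symm_apply,
      half_add_arctan_tan hv hv1]

lemma circleHomeo_exp (F : ℝ ≃o ℝ) {u : ℝ} (hu : 0 ≤ u) (hu1 : u < 1) :
    circleHomeo F (Circle.exp (2 * Real.pi * u)) = Circle.exp (2 * Real.pi * angleMap F u) := by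
  rcases hu.eq_or_lt with rfl | hu
  · rw [angleMap, if_pos rfl, mul_zero, Circle.exp_zero]
    exact circleHomeo_infty F
  · have h := half_add_arctan_mem (F (Real.tan (Real.pi * u - Real.pi / 2)))
    rw [exp_eq_cayleyInv hu hu1, circleHomeo_cayleyInv, angleMap_of_pos F hu,
      exp_eq_cayleyInv h.1 h.2, tan_half_add_arctan]

lemma orientationPreserving_circleHomeo (F : ℝ ≃o ℝ) : OrientationPreserving (circleHomeo F) := by
  have hpi := Real.two_pi_pos
  -- The lift, in units of full turns, is `angleMap` on each fundamental interval. It is strictly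
  -- increasing and surjective, so its continuity at the integers is automatic.
  set G : ℝ → ℝ := fun x => ⌊x⌋ + angleMap F (Int.fract x) with hG
  have hGm : StrictMono G := by
    intro x y hxy
    have hx := angleMap_mem F (Int.fract x)
    have hy := angleMap_mem F (Int.fract y)
    rcases (Int.floor_mono hxy.le).eq_or_lt with h | h
    · simp only [hG, h]
      refine add_lt_add_right (angleMap_lt F (Int.fract_nonneg _) ?_ (Int.fract_lt_one _)) _
      rw [Int.fract, Int.fract, h]
      linarith
    · have : (⌊x⌋ : ℝ) + 1 ≤ ⌊y⌋ := by exact_mod_cast h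
      simp only [hG]
      linarith [hx.2, hy.1]
  have hGs : Function.Surjective G := by
    intro y
    obtain ⟨u, hu, hu1, h⟩ := exists_angleMap_eq F (Int.fract_nonneg y) (Int.fract_lt_one y)
    refine ⟨⌊y⌋ + u, ?_⟩
    have hfl : ⌊(⌊y⌋ : ℝ) + u⌋ = ⌊y⌋ := by
      rw [Int.floor_intCast_add, Int.floor_eq_zero_iff.mpr ⟨hu, hu1⟩, add_zero]
    simp only [hG, hfl, Int.fract]
    rw [add_sub_cancel_left, h, Int.fract]
    ring
  have hGc : Continuous G := hGm.monotone.continuous_of_surjective hGs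
  refine ⟨fun x => 2 * Real.pi * G (x / (2 * Real.pi)), by fun_prop, fun x y hxy => ?_, fun x => ?_⟩
  · exact mul_lt_mul_of_pos_left (hGm (div_lt_div_of_pos_right hxy hpi)) hpi
  · set u := x / (2 * Real.pi) with hu
    have hx : x = 2 * Real.pi * Int.fract u + ⌊u⌋ * (2 * Real.pi) := by
      rw [Int.fract, hu]; field_simp; ring
    have hper : ∀ (t : ℝ) (n : ℤ), Circle.exp (t + n * (2 * Real.pi)) = Circle.exp t :=
      fun t n => Circle.exp_eq_exp.mpr ⟨n, rfl⟩
    have hR : 2 * Real.pi * G u =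
        2 * Real.pi * angleMap F (Int.fract u) + ⌊u⌋ * (2 * Real.pi) := by
      simp only [hG]; ring
    change _ = Circle.exp (2 * Real.pi * G u)
    rw [hR, hper, ← circleHomeo_exp F (Int.fract_nonneg u) (Int.fract_lt_one u),
      ← hper (2 * Real.pi * Int.fract u) ⌊u⌋, ← hx]

/-! ### Existence -/

section

variable {σ : SL(2, ℤ) → ℝ} (hσ : ∀ γ, σ (γ * S) = σ γ)
include hσ

lemma dev_mul_S_mul_S (γ : SL(2, ℤ)) (x : ℚ) : dev σ (γ * S * S) x = dev σ γ x := by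
  rw [dev, dev, hσ, hσ, devPos_mul_S_mul_S hσ, devPos_mul_S_mul_S hσ]

/-- As seen from any frame, the extension of the developing map to the circle differs from the
developing map of that frame by a Möbius transformation. -/
lemma exists_moebius_dev {F : ℝ ≃o ℝ} (hF : ∀ q : ℚ, F q = dev σ 1 q) (γ : SL(2, ℤ)) :
    ∃ a b c d : ℝ, a * d - b * c ≠ 0 ∧ (circleHomeo F (pt γ ∞) : ℂ) = homPt a c ∧
      ∀ q : ℚ, (circleHomeo F (pt γ (q : ℝ)) : ℂ) =
        homPt (a * dev σ γ q + b) (c * dev σ γ q + d) := by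
  have hS : ∀ γ, (∃ a b c d : ℝ, a * d - b * c ≠ 0 ∧ (circleHomeo F (pt γ ∞) : ℂ) = homPt a c ∧
      ∀ q : ℚ, (circleHomeo F (pt γ (q : ℝ)) : ℂ) =
        homPt (a * dev σ γ q + b) (c * dev σ γ q + d)) →
      (∃ a b c d : ℝ, a * d - b * c ≠ 0 ∧ (circleHomeo F (pt (γ * S) ∞) : ℂ) = homPt a c ∧
      ∀ q : ℚ, (circleHomeo F (pt (γ * S) (q : ℝ)) : ℂ) =
        homPt (a * dev σ (γ * S) q + b) (c * dev σ (γ * S) q + d)) := by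
    rintro γ ⟨a, b, c, d, hdet, hinf, hq⟩
    have he := (Real.exp_pos (σ γ)).ne'
    -- The old matrix composed with `y ↦ -exp (σ γ) / y`, as `dev_neg_inv` prescribes.
    refine ⟨b, -(a * Real.exp (σ γ)), d, -(c * Real.exp (σ γ)), ?_, ?_, fun q => ?_⟩
    · rw [show b * -(c * Real.exp (σ γ)) - -(a * Real.exp (σ γ)) * d =
        (a * d - b * c) * Real.exp (σ γ) by ring]
      exact mul_ne_zero hdet he
    · have := hq 0
      rw [dev_zero, Rat.cast_zero] at this
      rw [pt_mul_S_infty, this]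
      simp
    · rcases eq_or_ne q 0 with rfl | h0
      · rw [Rat.cast_zero, pt_mul_S_zero, hinf, dev_zero,
          ← homPt_smul (neg_ne_zero.mpr he)]
        congr 1 <;> ring
      · have h0' : (q : ℝ) ≠ 0 := by exact_mod_cast h0
        have := hq (-1 / q)
        have hne : dev σ (γ * S) q ≠ 0 := by
          rw [← dev_zero (γ * S)]
          exact (dev_strictMono _).injective.ne h0
        rw [dev_neg_inv hσ γ h0, ← homPt_smul hne] at this
        rw [pt_mul_S_coe γ h0', show -(q : ℝ)⁻¹ = ((-1 / q : ℚ) : ℝ) by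
          push_cast; rw [neg_div, one_div], this]
        congr 1 <;> field_simp <;> ring
  refine sl2z_induction ?_ hS ?_ ?_ ?_ γ
  · have f : ∀ w : OnePoint ℝ, pt 1 w = cayleyInv w := fun w => by rw [pt, map_one, one_smul]
    refine ⟨1, 0, 0, 1, by norm_num, ?_, fun q => ?_⟩
    · rw [f, circleHomeo_infty, cayleyInv_infty]
    · rw [f, circleHomeo_cayleyInv, cayleyInv_coe, hF]
      simp
  · intro γ hγ
    obtain ⟨a, b, c, d, hdet, hinf, hq⟩ := hS γ hγ
    refine ⟨a, b, c, d, hdet, by rw [pt_mul_S_inv, hinf], fun q => ?_⟩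
    rw [pt_mul_S_inv, hq, ← dev_mul_S_mul_S hσ (γ * S⁻¹), inv_mul_cancel_right]
  · rintro γ ⟨a, b, c, d, hdet, hinf, hq⟩
    -- The old matrix composed with `y ↦ exp (σ γ) * (1 + y)` from `dev_add_one`; for `T⁻¹` it is
    -- composed with the inverse of such a map.
    refine ⟨a * Real.exp (σ γ), a * Real.exp (σ γ) + b, c * Real.exp (σ γ),
      c * Real.exp (σ γ) + d, ?_, ?_, fun q => ?_⟩
    · rw [show a * Real.exp (σ γ) * (c * Real.exp (σ γ) + d) -
        (a * Real.exp (σ γ) + b) * (c * Real.exp (σ γ)) = (a * d - b * c) * Real.exp (σ γ) by ring]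
      exact mul_ne_zero hdet (Real.exp_pos _).ne'
    · rw [pt_mul_T_infty, hinf, ← homPt_smul (Real.exp_pos (σ γ)).ne', mul_comm, mul_comm c]
    · have := hq (q + 1)
      rw [dev_add_one hσ] at this
      push_cast at this
      rw [pt_mul_T_coe, this]
      congr 1 <;> ring
  · rintro γ ⟨a, b, c, d, hdet, hinf, hq⟩
    set E := Real.exp (σ (γ * T⁻¹)) with hE
    have he : E ≠ 0 := (Real.exp_pos _).ne'
    refine ⟨a / E, b - a, c / E, d - c, ?_, ?_, fun q => ?_⟩
    · rw [show a / E * (d - c) - (b - a) * (c / E) = (a * d - b * c) / E by ring]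
      exact div_ne_zero hdet he
    · rw [pt_mul_T_inv_infty, hinf, ← homPt_smul he (a / E)]
      congr 1 <;> field_simp
    · have h1 := dev_add_one hσ (γ * T⁻¹) (q - 1)
      rw [sub_add_cancel, inv_mul_cancel_right, ← hE] at h1
      have := hq (q - 1)
      push_cast at this
      rw [pt_mul_T_inv_coe, this, h1]
      congr 1 <;> field_simp <;> ring

lemma quadShear_circleHomeo {F : ℝ ≃o ℝ} (hF : ∀ q : ℚ, F q = dev σ 1 q) (γ : SL(2, ℤ)) :
    quadShear (circleHomeo F) γ = σ γ := by
  obtain ⟨a, b, c, d, hdet, hinf, hq⟩ := exists_moebius_dev hσ hF γ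
  have h0 := hq 0
  have h1 := hq 1
  have hn := hq (-1)
  rw [dev_zero, Rat.cast_zero, mul_zero, mul_zero, zero_add, zero_add] at h0
  rw [dev_one, Rat.cast_one] at h1
  rw [dev_neg_one hσ, Rat.cast_neg, Rat.cast_one] at hn
  set E := Real.exp (σ γ) with hE
  have hEp : 0 < E := Real.exp_pos _
  have hv : ∀ z : ℂ, z = ((1 : Circle) : ℂ) * z := fun z => by simp
  have hne : ∀ p q r s : ℝ, p * s - q * r ≠ 0 → p ≠ 0 ∨ q ≠ 0 := by
    intro p q r s h
    by_contra! h'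
    rw [h'.1, h'.2] at h
    simp at h
  -- In the coordinate of `dev σ γ` the corners are `∞, -1, 0, E`, with cross ratio `E`; the
  -- determinant of the Möbius map cancels.
  rw [quadShear, shear_eq, cr_mul_homPt 1 (hne _ _ b d ?_) (hne _ _ a c ?_) (hne _ _ a c ?_)
    (hne _ _ a c ?_) (hinf.trans (hv _)) (hn.trans (hv _)) (h0.trans (hv _)) (h1.trans (hv _))]
  · rw [show ((a * -1 + b) * c - a * (c * -1 + d)) * ((a * E + b) * d - b * (c * E + d)) /
      ((b * (c * -1 + d) - (a * -1 + b) * d) * ((a * E + b) * c - a * (c * E + d))) = E by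
        rw [show (a * -1 + b) * c - a * (c * -1 + d) = -(a * d - b * c) by ring,
          show (a * E + b) * d - b * (c * E + d) = E * (a * d - b * c) by ring,
          show b * (c * -1 + d) - (a * -1 + b) * d = a * d - b * c by ring,
          show (a * E + b) * c - a * (c * E + d) = -(a * d - b * c) by ring]
        field_simp, abs_of_pos hEp, hE, Real.log_exp]
  · rwa [mul_comm c]
  · rw [show (a * -1 + b) * c - (c * -1 + d) * a = -(a * d - b * c) by ring]
    exact neg_ne_zero.mpr hdet
  · rw [show b * c - d * a = -(a * d - b * c) by ring]
    exact neg_ne_zero.mpr hdet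
  · rw [show (a * E + b) * c - (c * E + d) * a = -(a * d - b * c) by ring]
    exact neg_ne_zero.mpr hdet

end

/-- A shear function with bounded sums along fans is induced by a homeomorphism. -/
theorem exists_induces {s : Edge → ℝ} (hs : FanSumsBounded s) : ∃ h, Induces s h := by
  obtain ⟨M, -, hM⟩ := hs
  set σ : SL(2, ℤ) → ℝ := fun γ => s (fan γ 0) with hσdef
  have hσ : ∀ γ, σ (γ * S) = σ γ := fun γ => congrArg s (fan_mul_S_zero γ)
  have hM' : ∀ (γ : SL(2, ℤ)) (n m : ℤ), n ≤ m → |∑ i ∈ Finset.Icc n m, σ (γ * T ^ i)| ≤ M := by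
    intro γ n m hnm
    simpa only [hσdef, ← fan_eq_fan_zero] using hM γ n m hnm
  obtain ⟨F, hF⟩ := exists_orderIso_extending (dev_strictMono (σ := σ) 1) (dev_denseRange hσ hM' 1)
  refine ⟨circleHomeo F, ⟨orientationPreserving_circleHomeo F, ?_⟩, ?_⟩
  -- The points `1`, `i`, `-1` are `∞`, `-1`, `0` in the half-plane, and the developing map fixes
  -- `-1` and `0`.
  · have h0 := hF 0
    have hn := hF (-1)
    rw [dev_zero, Rat.cast_zero] at h0
    rw [dev_neg_one hσ, Rat.cast_neg, Rat.cast_one] at hn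
    rintro z (hz | hz | hz)
    · have : z = cayleyInv ∞ := Circle.ext (by rw [hz, cayleyInv_infty]; simp [homPt])
      rw [this, circleHomeo_infty]
    · have : z = cayleyInv (-1 : ℝ) := Circle.ext (by
        rw [hz, cayleyInv_coe, homPt, eq_div_iff (homPt_den_ne_zero (by simp))]
        push_cast
        linear_combination Complex.I_sq)
      rw [this, circleHomeo_cayleyInv, hn]
    · have : z = cayleyInv (0 : ℝ) := Circle.ext (by
        rw [Set.mem_singleton_iff.mp hz, cayleyInv_coe]; simp [homPt])
      rw [this, circleHomeo_cayleyInv, h0]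
  · funext e
    rw [shearCoord, quadShear_circleHomeo hσ hF]
    exact congrArg s (frame_spec e)

end FareyShear

/-! ### The main theorem -/

theorem mainTheorem9 :
    (∀ s : FareyShear.Edge → ℝ, FareyShear.FanSumsBounded s →
      ∃ h : Circle ≃ₜ Circle, FareyShear.Induces s h ∧ FareyShear.Quasisymmetric h ∧
        ∀ h' : Circle ≃ₜ Circle, FareyShear.Induces s h' → h' = h) ∧
    (∀ h ∈ FareyShear.normalizedHomeo, FareyShear.shearCoord h ∈ FareyShear.classH →
      FareyShear.Quasisymmetric h) ∧
    FareyShear.classH ⊆ FareyShear.shearCoord '' FareyShear.universalTeichmuller := by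
  refine ⟨fun s hs => ?_, fun h hn hs => ?_, fun s hs => ?_⟩
  · obtain ⟨h, hn, rfl⟩ := FareyShear.exists_induces hs
    exact ⟨h, ⟨hn, rfl⟩, FareyShear.quasisymmetric_of_fanSumsBounded hn.1 hs,
      fun h' hh' => FareyShear.eq_of_shearCoord_eq hh'.1 hn hh'.2⟩
  · exact FareyShear.quasisymmetric_of_fanSumsBounded hn.1
      (FareyShear.fanSumsBounded_of_mem_classH hs)
  · have hb := FareyShear.fanSumsBounded_of_mem_classH hs
    obtain ⟨h, hn, rfl⟩ := FareyShear.exists_induces hb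
    exact ⟨h, ⟨hn, FareyShear.quasisymmetric_of_fanSumsBounded hn.1 hb⟩, rfl⟩
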